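/- A network has $n$ sensors of $K$ types, with $n_k\ge 1$ sensors of type $k$, $\sum_k n_k=n$. The samples of a sensor of type $k$ have law $p_{0,k}$ when the sensor is not affected by the anomaly and law $p_{1,k}\neq p_{0,k}$ when it is affected; these are probability measures on a common measurable space. Let $\mathcal S_{n,0}$ be the set of labels $\sigma:\{1,\dots,n\}\to\{1,\dots,K\}$ that take each value $j$ exactly $n_j$ times, and let $\mathcal S_{n,k}$ be the set of labels $\sigma:\{1,\dots,n\}\to\{1,\dots,K,K+k\}$ that take the value $j\ne k$, $j\le K$, exactly $n_j$ times, the value $k$ exactly $n_k-1$ times and the value $K+k$ exactly once. For a label $\sigma$ let $\mathbb P_\sigma$ be the law of a vector $X^n=(X_1,\dots,X_n)$ of independent samples with $X_i\sim p_{0,\sigma(i)}$ if $\sigma(i)\le K$ and $X_i\sim p_{1,\sigma(i)-K}$ if $\sigma(i)>K$. At the times $t=1,2,\dots$ one observes independent vectors $X^n[t]\sim\mathbb P_{\sigma_t}$ with unknown, arbitrary and time-varying labels $\sigma_t$. For a static anomaly of type $k$ with change point $\nu\ge 1$, $\sigma_t\in\mathcal S_{n,0}$ for $t<\nu$ and $\sigma_t\in\mathcal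 S_{n,k}$ for $t\ge\nu$; write $\Omega_k=(\sigma_t)_{t\ge1}$ for such a sequence and $\mathbb E^{k,\nu}_{\Omega_k}$ for the expectation. When there is no change, $\Omega=(\sigma_t)_{t\ge 1}$ with all $\sigma_t\in\mathcal S_{n,0}$, and the expectation is $\mathbb E^\infty_\Omega$. For a stopping time $\tau$ of the observed sequence, with values in $\{0,1,2,\dots\}\cup\{\infty\}$, put $$\mathrm{WADD}(\tau)=\sup_{\nu\ge1}\ \sup_{1\le k\le K}\ \sup_{\Omega_k}\ \operatorname{ess\,sup}\ \mathbb E^{k,\nu}_{\Omega_k}\big[(\tau-\nu)^+\,\big|\,X^n[1],\dots,X^n[\nu-1]\big],\qquad \mathrm{WARL}(\tau)=\inf_{\Omega}\mathbb E^\infty_\Omega[\tau].$$ Let $\widetilde{\mathbb P}_0=\frac1{|\mathcal S_{n,0}|}\sum_{\sigma\in\mathcal S_{n,0}}\mathbb P_\sigma$, $\widetilde{\mathbb P}^k=\frac1{|\mathcal S_{n,k}|}\sum_{\sigma\in\mathcal S_{n,k}}\mathbb P_\sigma$, and $I^*=\min_{1\le k\le K}D(\widetilde{\mathbb P}^k\,\|\,\widetilde{\mathbb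 P}_0)$, where $D$ is the Kullback-Leibler divergence with values in $[0,\infty]$ and $\log\gamma/\infty=0$. **Theorem.** As $\gamma\to\infty$, $$\inf_{\tau:\ \mathrm{WARL}(\tau)\ge\gamma}\mathrm{WADD}(\tau)\ \ge\ \frac{\log\gamma}{I^*}+O(1),$$ that is, there is a finite constant $C\ge 0$, depending only on $n$, $K$, $(n_k)$, $(p_{0,k})$ and $(p_{1,k})$, such that for all sufficiently large $\gamma$ every stopping time $\tau$ with $\mathrm{WARL}(\tau)\ge\gamma$ satisfies $\mathrm{WADD}(\tau)\ge \log\gamma/I^*-C$. -/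

import Mathlib

open MeasureTheory ProbabilityTheory Filter
open scoped ENNReal NNReal

noncomputable section

namespace UnlabeledQCD

/-- The `2K` groups of sensors: `Sum.inl j` are the sensors of type `j` that are not affected by the
anomaly, `Sum.inr j` those of type `j` that are affected. -/
abbrev Group (K : ℕ) : Type := Fin K ⊕ Fin K

/-- The number of sensors in each group when there are `m j` sensors of type `j` and the type of the
affected sensor is `s` (`none`: there is no anomaly). -/
def groupSize {K : ℕ} (m : Fin K → ℕ) : Option (Fin K) → Group K → ℕ
  | none, Sum.inl j => m j
  | none, Sum.inr _ => 0
  | some k, Sum.inl j => if j = k then m j - 1 else m j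
  | some k, Sum.inr j => if j = k then 1 else 0

/-- The collection of all possible labels of the `n` samples when the type of the affected sensor
is `s`: the maps from samples to groups with the prescribed group sizes. -/
def labels {K : ℕ} (n : ℕ) (m : Fin K → ℕ) (s : Option (Fin K)) : Finset (Fin n → Group K) :=
  {σ | ∀ g, Finset.card {i | σ i = g} = groupSize m s g}

variable {X : Type*} [MeasurableSpace X]

/-- The law of the `n` independent samples at one time step under the label `σ`; sample `i` is drawn
from `p₀ j` if `σ i = Sum.inl j` and from `p₁ j` if `σ i = Sum.inr j`. -/
def vectorLaw {K n : ℕ} (p₀ p₁ : Fin K → Measure X) (σ : Fin n → Group K) :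
    Measure (Fin n → X) :=
  Measure.pi fun i => Sum.elim p₀ p₁ (σ i)

/-- The uniform mixture of the laws `vectorLaw p₀ p₁ σ` over all possible labels `σ`. -/
def mixture {K : ℕ} (n : ℕ) (m : Fin K → ℕ) (p₀ p₁ : Fin K → Measure X) (s : Option (Fin K)) :
    Measure (Fin n → X) :=
  ((labels n m s).card : ℝ≥0∞)⁻¹ • ∑ σ ∈ labels n m s, vectorLaw p₀ p₁ σ

/-- The smallest Kullback-Leibler divergence from the pre-change mixture to a post-change
mixture, over the type `k` of the affected sensor. -/
def minKL {K : ℕ} (n : ℕ) (m : Fin K → ℕ) (p₀ p₁ : Fin K → Measure X) : ℝ≥0∞ :=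
  ⨅ k : Fin K,
    InformationTheory.klDiv (mixture n m p₀ p₁ (some k)) (mixture n m p₀ p₁ none)

/-- A sample path; `ω i` is the vector of the `n` samples received at time `i + 1`,
so that time runs through `1, 2, 3, …`. -/
abbrev Path (n : ℕ) (X : Type*) : Type _ := ℕ → Fin n → X

/-- The law of the sequence of sample vectors, independent over time, when `Ω i` is the label at
time `i + 1`. -/
def pathLaw {K n : ℕ} (p₀ p₁ : Fin K → Measure X) (Ω : ℕ → Fin n → Group K) :
    Measure (Path n X) :=
  Measure.infinitePi fun i => vectorLaw p₀ p₁ (Ω i)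

/-- The type of the affected sensor at time `i + 1` for a static anomaly of type `k` with change
point `ν`. -/
def staticTrajectory {K : ℕ} (k : Fin K) (ν : ℕ) (i : ℕ) : Option (Fin K) :=
  if i + 1 < ν then none else some k

/-- The information available at time `t`, i.e. the σ-algebra generated by the sample vectors
received at the times `1, …, t`. -/
def obsFiltration (n : ℕ) (X : Type*) [MeasurableSpace X] :
    Filtration ℕ (inferInstance : MeasurableSpace (Path n X)) where
  seq t := MeasurableSpace.comap (fun (ω : Path n X) (i : Set.Iio t) => ω i) inferInstance
  mono' s t hst := by
    rintro _ ⟨A, hA, rfl⟩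
    refine ⟨(fun (x : Set.Iio t → Fin n → X) (i : Set.Iio s) =>
      x ⟨i, lt_of_lt_of_le i.2 hst⟩) ⁻¹' A, ?_, rfl⟩
    exact (by fun_prop : Measurable fun (x : Set.Iio t → Fin n → X) (i : Set.Iio s) =>
      x ⟨i, lt_of_lt_of_le i.2 hst⟩) hA
  le' t := by
    apply Measurable.comap_le
    fun_prop

/-- Worst-case average running length: the infimum of the mean of `τ` in the absence of a change,
over all sequences of labels. -/
def WARL {K n : ℕ} (m : Fin K → ℕ) (p₀ p₁ : Fin K → Measure X) (τ : Path n X → ℕ∞) : ℝ≥0∞ :=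
  ⨅ (Ω : ℕ → Fin n → Group K) (_ : ∀ i, Ω i ∈ labels n m none),
    ∫⁻ ω, (τ ω : ℝ≥0∞) ∂(pathLaw p₀ p₁ Ω)

/-- Worst-case average detection delay for a static anomaly: the supremum, over all change points
`ν ≥ 1`, all types `k` of the affected sensor and all sequences `Ω` of labels, of the essential
supremum of the conditional expectation of `(τ - ν)⁺` given the samples up to time `ν - 1`.
The subtraction in `ℕ∞` is truncated at `0`. -/
def WADD {K n : ℕ} (m : Fin K → ℕ) (p₀ p₁ : Fin K → Measure X) (τ : Path n X → ℕ∞) : ℝ≥0∞ :=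
  ⨆ (ν : ℕ) (_ : 1 ≤ ν) (k : Fin K) (Ω : ℕ → Fin n → Group K)
    (_ : ∀ i, Ω i ∈ labels n m (staticTrajectory k ν i)),
    essSup
      (condLExp (obsFiltration n X (ν - 1)) (pathLaw p₀ p₁ Ω)
        fun ω => ((τ ω - (ν : ℕ∞) : ℕ∞) : ℝ≥0∞))
      (pathLaw p₀ p₁ Ω)

end UnlabeledQCD

end

noncomputable section

namespace UnlabeledQCD
-- Infinite product measures with one factor replaced
section InfiniteProduct

variable {Y : Type*} [MeasurableSpace Y]

/-! Random labels reduce the problem to a change from i.i.d. `Q` (the mixture without anomaly) to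
i.i.d. `P` (the mixture for a type `k` attaining `minKL`). A delay bound valid for every label
sequence survives averaging over labels (`lintegral_mixture_le_of_labels`), and some label sequence
has mean of `τ` at most the average (`exists_labels_lintegral_le`), so under `Q` the mean of `τ` is
still at least `γ`.

For the i.i.d. problem let `L = dP/dQ`, `D = D(P‖Q)`, and let `S` be the CUSUM statistic with
reflection increments `b`, `b 0 = 1`. Put `d = WADD` and let `N`, `S̄`, `R` be the sums over `t < M`
of the `Q`-means of `b t`, `S t`, `√(S t)` on `{t < τ}`. Three inequalities suffice. Delay: `S t` is
a sum over `a ≤ t` of `b a` times the likelihood ratio of a change after time `a`; changing measure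
gives `S̄ ≤ (d + 1) N` (`sum_cusum_le`). Entropy: the drift of a convex potential built on `x log x`
gives `ℓ N ≤ e^ℓ + D S̄` for all `ℓ ≥ 0` (`log_mul_sum_push_le`); with `ℓ = log N` this yields `log
N ≤ 1 + D (d + 1)`. Contraction: `√S` shrinks in mean by `ρ = E_Q √L < 1` apart from the increments,
so `(1 - ρ) R ≤ N` (`sum_sqrt_cusum_le`), while `S ≥ 1` gives `R ≥ γ / 2` for large `M`. Hence `log
γ ≤ D d + O(1)`. Both `ρ < 1` and `D > 0` rest on `P ≠ Q` (`mixture_ne`). -/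

instance isProbabilityMeasure_update (μ : ℕ → Measure Y) [∀ i, IsProbabilityMeasure (μ i)]
    (n : ℕ) (ν : Measure Y) [IsProbabilityMeasure ν] (i : ℕ) :
    IsProbabilityMeasure (Function.update μ n ν i) := by
  by_cases h : i = n
  · subst h; simpa
  · simpa [h] using inferInstanceAs (IsProbabilityMeasure (μ i))

lemma measurable_update_prod (n : ℕ) :
    Measurable fun p : Y × (ℕ → Y) => Function.update p.2 n p.1 := by
  refine measurable_pi_lambda _ fun i => ?_
  by_cases h : i = n
  · subst h; simpa using measurable_fst
  · simpa [h] using show Measurable fun p : Y × (ℕ → Y) => p.2 i by fun_prop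

lemma infinitePi_update (μ : ℕ → Measure Y) [∀ i, IsProbabilityMeasure (μ i)] (n : ℕ)
    (ν : Measure Y) [IsProbabilityMeasure ν] :
    Measure.infinitePi (Function.update μ n ν) =
      (ν.prod (Measure.infinitePi μ)).map fun p => Function.update p.2 n p.1 := by
  symm
  apply Measure.eq_infinitePi
  intro s t ht
  rw [Measure.map_apply (measurable_update_prod n) (MeasurableSet.pi s.countable_toSet
    fun i _ => ht i)]
  have hpre : (fun p : Y × (ℕ → Y) => Function.update p.2 n p.1) ⁻¹' (Set.pi s t) =
      (if n ∈ s then t n else Set.univ) ×ˢ Set.pi (s.erase n : Finset ℕ) t := by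
    ext ⟨y, ω⟩
    simp only [Set.mem_preimage, Set.mem_pi, Finset.mem_coe, Set.mem_prod, Finset.mem_erase]
    constructor
    · intro h
      refine ⟨?_, fun i hi => by simpa [hi.1] using h i hi.2⟩
      split_ifs with hn
      · simpa using h n hn
      · trivial
    · rintro ⟨h1, h2⟩ i hi
      by_cases hin : i = n
      · subst hin; simpa [hi] using h1
      · simpa [hin] using h2 i ⟨hin, hi⟩
  rw [hpre, Measure.prod_prod, Measure.infinitePi_pi μ (fun i _ => ht i)]
  by_cases hn : n ∈ s
  · rw [if_pos hn, ← Finset.mul_prod_erase s _ hn, Function.update_self]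
    congr 1
    exact Finset.prod_congr rfl fun i hi => by
      rw [Function.update_of_ne (Finset.ne_of_mem_erase hi)]
  · rw [if_neg hn, measure_univ, one_mul, Finset.erase_eq_of_notMem hn]
    exact Finset.prod_congr rfl fun i hi => by
      rw [Function.update_of_ne (ne_of_mem_of_not_mem hi hn)]

lemma lintegral_infinitePi_update (μ : ℕ → Measure Y) [∀ i, IsProbabilityMeasure (μ i)] (n : ℕ)
    (ν : Measure Y) [IsProbabilityMeasure ν] {f : (ℕ → Y) → ℝ≥0∞} (hf : Measurable f) :
    ∫⁻ ω, f ω ∂(Measure.infinitePi (Function.update μ n ν)) =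
      ∫⁻ y, ∫⁻ ω, f (Function.update ω n y) ∂(Measure.infinitePi μ) ∂ν := by
  rw [infinitePi_update, lintegral_map hf (measurable_update_prod n),
    lintegral_prod (fun p : Y × (ℕ → Y) => f (Function.update p.2 n p.1))
      (hf.comp (measurable_update_prod n)).aemeasurable]

lemma lintegral_infinitePi_eq_lintegral_update (μ : ℕ → Measure Y)
    [∀ i, IsProbabilityMeasure (μ i)] (n : ℕ) {f : (ℕ → Y) → ℝ≥0∞} (hf : Measurable f) :
    ∫⁻ ω, f ω ∂(Measure.infinitePi μ) =
      ∫⁻ ω, ∫⁻ y, f (Function.update ω n y) ∂(μ n) ∂(Measure.infinitePi μ) := by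
  conv_lhs => rw [← Function.update_eq_self n μ]
  rw [lintegral_infinitePi_update μ n (μ n) hf]
  exact lintegral_lintegral_swap (hf.comp (measurable_update_prod n)).aemeasurable

lemma lintegral_infinitePi_update_withDensity (μ : ℕ → Measure Y)
    [∀ i, IsProbabilityMeasure (μ i)] (n : ℕ) {L : Y → ℝ≥0} (hL : Measurable L)
    (ν : Measure Y) [IsProbabilityMeasure ν]
    (hν : ν = (μ n).withDensity fun y => (L y : ℝ≥0∞))
    {f : (ℕ → Y) → ℝ≥0∞} (hf : Measurable f) :
    ∫⁻ ω, f ω ∂(Measure.infinitePi (Function.update μ n ν)) =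
      ∫⁻ ω, f ω * L (ω n) ∂(Measure.infinitePi μ) := by
  have hLn : Measurable fun ω : ℕ → Y => (L (ω n) : ℝ≥0∞) := by fun_prop
  have hm : Measurable fun y => ∫⁻ ω, f (Function.update ω n y) ∂(Measure.infinitePi μ) :=
    (hf.comp (measurable_update_prod n)).lintegral_prod_right'
  conv_rhs => rw [← Function.update_eq_self n μ]
  rw [lintegral_infinitePi_update μ n ν hf,
    lintegral_infinitePi_update μ n (μ n) (f := fun ω => f ω * L (ω n)) (hf.mul hLn), hν,
    lintegral_withDensity_eq_lintegral_mul _ (by fun_prop) hm]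
  refine lintegral_congr fun y => ?_
  have hy : Measurable fun ω : ℕ → Y => f (Function.update ω n y) :=
    hf.comp ((measurable_update_prod n).comp (measurable_const.prodMk measurable_id))
  simp only [Function.update_self, Pi.mul_apply]
  rw [lintegral_mul_const _ hy, mul_comm]

lemma lintegral_infinitePi_update_mixture (μ : ℕ → Measure Y)
    [∀ i, IsProbabilityMeasure (μ i)] (n : ℕ) {ι : Type*} (s : Finset ι) (p : ι → Measure Y)
    [∀ i, IsProbabilityMeasure (p i)] (c : ℝ≥0∞) (ν : Measure Y) [IsProbabilityMeasure ν]
    (hν : ν = c • ∑ i ∈ s, p i) {f : (ℕ → Y) → ℝ≥0∞} (hf : Measurable f) :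
    ∫⁻ ω, f ω ∂(Measure.infinitePi (Function.update μ n ν)) =
      c * ∑ i ∈ s, ∫⁻ ω, f ω ∂(Measure.infinitePi (Function.update μ n (p i))) := by
  rw [lintegral_infinitePi_update μ n ν hf, hν, lintegral_smul_measure,
    lintegral_finsetSum_measure, smul_eq_mul]
  simp_rw [lintegral_infinitePi_update μ n _ hf]

end InfiniteProduct

/-! ### Functions of the first `t` sample vectors -/

section Adapted

variable {n : ℕ} {X : Type*} [MeasurableSpace X]

lemma eq_of_measurable_obsFiltration {t : ℕ} {f : Path n X → ℝ≥0∞}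
    (hf : Measurable[obsFiltration n X t] f) {ω ω' : Path n X} (h : ∀ i < t, ω i = ω' i) :
    f ω = f ω' :=
  hf.factorsThrough (by ext1 i; exact h i i.2)

lemma lintegral_infinitePi_congr {μ μ' : ℕ → Measure (Fin n → X)}
    [∀ i, IsProbabilityMeasure (μ i)] [∀ i, IsProbabilityMeasure (μ' i)] {t : ℕ}
    (h : ∀ i < t, μ i = μ' i) {f : Path n X → ℝ≥0∞}
    (hf : Measurable[obsFiltration n X t] f) :
    ∫⁻ ω, f ω ∂(Measure.infinitePi μ) = ∫⁻ ω, f ω ∂(Measure.infinitePi μ') := by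
  rw [← lintegral_trim ((obsFiltration n X).le t) hf,
    ← lintegral_trim ((obsFiltration n X).le t) hf]
  congr 1
  refine @Measure.ext _ (obsFiltration n X t) _ _ fun s hs => ?_
  rw [trim_measurableSet_eq _ hs, trim_measurableSet_eq _ hs]
  obtain ⟨A, hA, rfl⟩ := hs
  have hm : Measurable ((Set.Iio t).domRestrict : Path n X → _) := by fun_prop
  change Measure.infinitePi μ ((Set.Iio t).domRestrict ⁻¹' A) =
    Measure.infinitePi μ' ((Set.Iio t).domRestrict ⁻¹' A)
  rw [← Measure.map_apply hm hA, ← Measure.map_apply hm hA, Measure.infinitePi_map_restrict',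
    Measure.infinitePi_map_restrict']
  have : (fun i : Set.Iio t => μ i) = fun i : Set.Iio t => μ' i := funext fun i => h i i.2
  rw [this]

lemma measurable_obsFiltration_apply {t i : ℕ} (h : i < t) :
    Measurable[obsFiltration n X t] fun ω : Path n X => ω i :=
  (measurable_pi_apply (⟨i, h⟩ : Set.Iio t)).comp
    (comap_measurable fun (ω : Path n X) (j : Set.Iio t) => ω j)

/-- Level `t` of the filtration sees the coordinates `0, …, t - 1` only; coordinate `t` is the next,
still unseen vector. -/
lemma update_apply_of_measurable {t : ℕ} {f : Path n X → ℝ≥0∞}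
    (hf : Measurable[obsFiltration n X t] f) (ω : Path n X) (y : Fin n → X) :
    f (Function.update ω t y) = f ω :=
  eq_of_measurable_obsFiltration hf fun _ hi => Function.update_of_ne hi.ne _ _

end Adapted

/-- The density of a change to `L • Q` at all times in `[a, b)`. -/
lemma lintegral_infinitePi_change {n : ℕ} {X : Type*} [MeasurableSpace X]
    {Q P : Measure (Fin n → X)} [IsProbabilityMeasure Q] [IsProbabilityMeasure P]
    {L : (Fin n → X) → ℝ≥0} (hL : Measurable L)
    (hP : P = Q.withDensity fun y => (L y : ℝ≥0∞)) (μ : ℕ → Measure (Fin n → X))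
    [∀ i, IsProbabilityMeasure (μ i)] {a b : ℕ} (hab : a ≤ b)
    (hμ : ∀ i < b, μ i = if i < a then Q else P) {f : Path n X → ℝ≥0∞}
    (hf : Measurable[obsFiltration n X b] f) :
    ∫⁻ ω, f ω ∂(Measure.infinitePi μ) =
      ∫⁻ ω, f ω * ∏ i ∈ Finset.Ico a b, (L (ω i) : ℝ≥0∞) ∂(Measure.infinitePi fun _ => Q) := by
  have inst : ∀ b i : ℕ, IsProbabilityMeasure (if i < a then Q else if i < b then P else Q) := by
    intro b i; split_ifs <;> infer_instance
  -- With `Q` restored from `b` on, consecutive laws differ in one factor, so the induction on `b`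
  -- gains one density at a time.
  have key : ∀ b, a ≤ b → ∀ f : Path n X → ℝ≥0∞, Measurable f →
      ∫⁻ ω, f ω ∂(Measure.infinitePi fun i => if i < a then Q else if i < b then P else Q) =
      ∫⁻ ω, f ω * ∏ i ∈ Finset.Ico a b, (L (ω i) : ℝ≥0∞) ∂(Measure.infinitePi fun _ => Q) := by
    intro b hb
    induction b, hb using Nat.le_induction with
    | base =>
      intro f hf
      have : (fun i => if i < a then Q else if i < a then P else Q) = fun _ => Q := by
        ext1 i; split_ifs <;> rfl
      simp [this]
    | succ b hb ih =>
      intro f hf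
      have hup : (fun i => if i < a then Q else if i < b + 1 then P else Q) =
          Function.update (fun i => if i < a then Q else if i < b then P else Q) b P := by
        ext1 i
        rcases lt_trichotomy i b with h | h | h
        · simp [h.ne, h, Nat.lt_succ_of_lt h]
        · subst h; simp [not_lt.mpr hb]
        · simp [h.ne', not_lt.mpr h.le, not_lt.mpr (Nat.succ_le_of_lt h)]
      rw [hup, lintegral_infinitePi_update_withDensity _ b hL P (by simp [not_lt.mpr hb, hP]) hf,
        ih (fun ω => f ω * L (ω b)) (hf.mul (by fun_prop))]
      refine lintegral_congr fun ω => ?_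
      rw [Finset.prod_Ico_succ_top hb, mul_assoc, mul_comm (L (ω b) : ℝ≥0∞)]
  rw [← key b hab f (hf.mono ((obsFiltration n X).le b) le_rfl)]
  exact lintegral_infinitePi_congr (fun i hi => by simp [hμ i hi, hi]) hf

/-! ### The CUSUM statistic and its drift under `Q` -/

section Lorden

section Cusum

variable {Y : Type*}

/-- The statistic `S 0 = 1`, `S (t + 1) = max (S t * L (ω t)) 1`. -/
def cusum (L : Y → ℝ≥0) : ℕ → (ℕ → Y) → ℝ≥0
  | 0, _ => 1
  | t + 1, ω => max (cusum L t ω * L (ω t)) 1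

/-- The increments `(1 - S t * L (ω t))⁺` that keep `cusum` above `1`. -/
def cusumPush (L : Y → ℝ≥0) : ℕ → (ℕ → Y) → ℝ≥0
  | 0, _ => 1
  | t + 1, ω => 1 - cusum L t ω * L (ω t)

lemma one_le_cusum (L : Y → ℝ≥0) (t : ℕ) (ω : ℕ → Y) : 1 ≤ cusum L t ω := by
  cases t
  · exact le_rfl
  · exact le_max_right _ _

lemma cusumPush_le_one (L : Y → ℝ≥0) (t : ℕ) (ω : ℕ → Y) : cusumPush L t ω ≤ 1 := by
  cases t
  · exact le_rfl
  · exact tsub_le_self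

lemma cusum_succ (L : Y → ℝ≥0) (t : ℕ) (ω : ℕ → Y) :
    cusum L (t + 1) ω = cusum L t ω * L (ω t) + cusumPush L (t + 1) ω :=
  add_tsub_eq_max.symm

/-- Unrolling the linear recursion: mass injected at time `a` is afterwards multiplied by the
likelihood ratio of a change after `a`. This links the statistic to detection delays. -/
lemma cusum_eq_sum (L : Y → ℝ≥0) (t : ℕ) (ω : ℕ → Y) :
    cusum L t ω =
      ∑ a ∈ Finset.range (t + 1), cusumPush L a ω * ∏ i ∈ Finset.Ico a t, L (ω i) := by
  induction t with
  | zero => simp [cusum, cusumPush]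
  | succ t ih =>
    rw [cusum_succ, ih, Finset.sum_range_succ _ (t + 1), Finset.Ico_self, Finset.prod_empty,
      mul_one, Finset.sum_mul]
    congr 1
    refine Finset.sum_congr rfl fun a ha => ?_
    rw [Finset.prod_Ico_succ_top (Nat.lt_succ_iff.mp (Finset.mem_range.mp ha)), mul_assoc]

end Cusum

variable {n : ℕ} {X : Type*} [MeasurableSpace X] {L : (Fin n → X) → ℝ≥0}
  {Q : Measure (Fin n → X)}

lemma measurable_cusum (hL : Measurable L) (t : ℕ) :
    Measurable[obsFiltration n X t] (cusum L t : Path n X → ℝ≥0) := by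
  induction t with
  | zero => exact measurable_const
  | succ t ih =>
    exact ((ih.mono ((obsFiltration n X).mono t.le_succ) le_rfl).mul
      (hL.comp (measurable_obsFiltration_apply t.lt_succ_self))).max measurable_const

lemma measurable_cusumPush (hL : Measurable L) (t : ℕ) :
    Measurable[obsFiltration n X t] (cusumPush L t : Path n X → ℝ≥0) := by
  cases t with
  | zero => exact measurable_const
  | succ t =>
    exact measurable_const.sub
      (((measurable_cusum hL t).mono ((obsFiltration n X).mono t.le_succ) le_rfl).mul
        (hL.comp (measurable_obsFiltration_apply t.lt_succ_self)))

/-- The vector `ω t` is independent of level `t`, so it can be integrated out with the past frozen.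
-/
lemma lintegral_infinitePi_adapted_mul [IsProbabilityMeasure Q] {t : ℕ} {φ : Path n X → ℝ≥0∞}
    (hφ : Measurable[obsFiltration n X t] φ) {s : Path n X → ℝ≥0}
    (hs : Measurable[obsFiltration n X t] s) {G : ℝ≥0 → (Fin n → X) → ℝ≥0∞}
    (hG : Measurable (Function.uncurry G)) :
    ∫⁻ ω, φ ω * G (s ω) (ω t) ∂(Measure.infinitePi fun _ => Q) =
      ∫⁻ ω, φ ω * ∫⁻ y, G (s ω) y ∂Q ∂(Measure.infinitePi fun _ => Q) := by
  have hφ' := hφ.mono ((obsFiltration n X).le t) le_rfl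
  have hs' := hs.mono ((obsFiltration n X).le t) le_rfl
  rw [lintegral_infinitePi_eq_lintegral_update (fun _ => Q) t (f := fun ω => φ ω * G (s ω) (ω t))
    (hφ'.mul (hG.comp (hs'.prodMk (measurable_pi_apply t))))]
  refine lintegral_congr fun ω => ?_
  have hs_up : ∀ y, s (Function.update ω t y) = s ω := fun y =>
    ENNReal.coe_injective (update_apply_of_measurable (f := fun ω => (s ω : ℝ≥0∞))
      (measurable_coe_nnreal_ennreal.comp hs) ω y)
  simp only [update_apply_of_measurable hφ, hs_up, Function.update_self]
  exact lintegral_const_mul _ (hG.comp (measurable_const.prodMk measurable_id))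

/-! ### The entropy potential -/

section Potential

/-- A nonnegative convex function with minimum at `exp ℓ`. -/
def klPotential (ℓ x : ℝ) : ℝ := x * Real.log x - x * (1 + ℓ) + Real.exp ℓ

lemma klPotential_nonneg (ℓ : ℝ) {x : ℝ} (hx : 0 ≤ x) : 0 ≤ klPotential ℓ x := by
  unfold klPotential
  rcases hx.eq_or_lt with rfl | hx
  · simpa using (Real.exp_pos ℓ).le
  · have h := mul_le_mul_of_nonneg_left (Real.add_one_le_exp (ℓ - Real.log x)) hx.le
    rw [Real.exp_sub, Real.exp_log hx, mul_div_cancel₀ _ hx.ne'] at h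
    linarith

lemma measurable_klPotential (ℓ : ℝ) : Measurable (klPotential ℓ) := by
  unfold klPotential; fun_prop

/-- Reflecting from `v < 1` up to `1` pays at least `ℓ` per unit of push; this reduces to `v - 1 ≤ v
log v`. -/
lemma klPotential_max_add_le (ℓ : ℝ) (v : ℝ≥0) :
    klPotential ℓ (max v 1 : ℝ≥0) + ℓ * (1 - v : ℝ≥0) ≤ klPotential ℓ v := by
  rcases le_total 1 v with h | h
  · simp [max_eq_left h, tsub_eq_zero_of_le h]
  · rw [max_eq_right h, NNReal.coe_sub h]
    have hv : (v : ℝ) - 1 ≤ v * Real.log v := by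
      have := InformationTheory.klFun_nonneg v.coe_nonneg
      rw [InformationTheory.klFun_apply] at this
      linarith
    simp only [klPotential, NNReal.coe_one, Real.log_one]
    linarith

/-- Before reflection, `E[L] = 1` and `log (s L) = log s + log L` make the mean potential grow by
exactly `s D`; reflection then costs at least `ℓ` times the push. -/
lemma lintegral_klPotential_step [IsProbabilityMeasure Q] (hL : Measurable L)
    (hL1 : ∫⁻ y, L y ∂Q = 1)
    (hkl : Integrable (fun y => InformationTheory.klFun (L y)) Q) {ℓ : ℝ} (hℓ : 0 ≤ ℓ)
    {s : ℝ≥0} (hs : 1 ≤ s) :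
    ∫⁻ y, (ENNReal.ofReal (klPotential ℓ (max (s * L y) 1 : ℝ≥0)) +
        ENNReal.ofReal ℓ * (1 - s * L y : ℝ≥0)) ∂Q ≤
      ENNReal.ofReal (klPotential ℓ s) +
        ENNReal.ofReal (∫ y, InformationTheory.klFun (L y) ∂Q) * s := by
  have hs0 : (s : ℝ) ≠ 0 := by
    have : (1 : ℝ) ≤ s := by exact_mod_cast hs
    positivity
  have hLint : Integrable (fun y => (L y : ℝ)) Q :=
    ⟨by fun_prop, by simp [HasFiniteIntegral, hL1]⟩
  have hLone : ∫ y, (L y : ℝ) ∂Q = 1 := by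
    rw [integral_eq_lintegral_of_nonneg_ae (by filter_upwards with y using by simp) (by fun_prop)]
    simp [hL1]
  have hform : ∀ y, klPotential ℓ (s * L y) = s * InformationTheory.klFun (L y) +
      (s * (Real.log s - ℓ)) * L y + (Real.exp ℓ - s) := by
    intro y
    unfold klPotential
    rw [InformationTheory.klFun_apply]
    rcases eq_or_ne (L y : ℝ) 0 with h | h
    · simp [h]
    · rw [Real.log_mul hs0 h]
      ring
  have hint : Integrable (fun y => klPotential ℓ (s * L y)) Q := by
    simp_rw [hform]
    exact ((hkl.const_mul _).add (hLint.const_mul _)).add (integrable_const _)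
  have hval : ∫ y, klPotential ℓ (s * L y) ∂Q =
      s * ∫ y, InformationTheory.klFun (L y) ∂Q + klPotential ℓ s := by
    simp_rw [hform]
    rw [integral_add (f := fun y => s * InformationTheory.klFun (L y) +
        (s * (Real.log s - ℓ)) * L y) ((hkl.const_mul _).add (hLint.const_mul _))
        (integrable_const _), integral_add (hkl.const_mul _) (hLint.const_mul _),
      integral_const_mul, integral_const_mul, hLone]
    simp [klPotential]
    ring
  have hkl0 : 0 ≤ ∫ y, InformationTheory.klFun (L y) ∂Q :=
    integral_nonneg fun y => InformationTheory.klFun_nonneg (L y).coe_nonneg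
  calc
    _ ≤ ∫⁻ y, ENNReal.ofReal (klPotential ℓ (s * L y)) ∂Q := by
      refine lintegral_mono fun y => ?_
      rw [← ENNReal.ofReal_coe_nnreal (p := 1 - s * L y), ← ENNReal.ofReal_mul hℓ,
        ← ENNReal.ofReal_add (klPotential_nonneg ℓ (NNReal.coe_nonneg _)) (by positivity)]
      refine ENNReal.ofReal_le_ofReal ?_
      have := klPotential_max_add_le ℓ (s * L y)
      rwa [NNReal.coe_mul] at this
    _ = ENNReal.ofReal (s * ∫ y, InformationTheory.klFun (L y) ∂Q + klPotential ℓ s) := by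
      rw [← hval, ofReal_integral_eq_lintegral_ofReal hint]
      filter_upwards with y using klPotential_nonneg ℓ (by positivity)
    _ = _ := by
      rw [ENNReal.ofReal_add (by positivity) (klPotential_nonneg ℓ s.coe_nonneg),
        ENNReal.ofReal_mul s.coe_nonneg, ENNReal.ofReal_coe_nnreal, add_comm, mul_comm]

end Potential

/-- Below `1` one has `v ≤ √v`. -/
lemma sqrt_max_one_le (v : ℝ≥0) : NNReal.sqrt (max v 1) ≤ NNReal.sqrt v + (1 - v) := by
  rcases le_total 1 v with h | h
  · simp [max_eq_left h]
  · rw [max_eq_right h, NNReal.sqrt_one]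
    have : v ≤ NNReal.sqrt v := by
      rw [NNReal.le_sqrt_iff_sq_le]
      exact pow_le_of_le_one zero_le h two_ne_zero
    calc (1 : ℝ≥0) = v + (1 - v) := (add_tsub_cancel_of_le h).symm
      _ ≤ _ := by gcongr

/-! ### Drift inequalities summed up to a stopping time -/

section Sums

/-- The expectation of `f` on the event `A` when the sample vectors are i.i.d. with law `Q`. -/
def iidMean (Q : Measure (Fin n → X)) (A : Set (Path n X)) (f : Path n X → ℝ≥0∞) : ℝ≥0∞ :=
  ∫⁻ ω, A.indicator 1 ω * f ω ∂(Measure.infinitePi fun _ => Q)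

lemma iidMean_mono {A A' : Set (Path n X)} (hA : A ⊆ A') {f f' : Path n X → ℝ≥0∞}
    (hf : ∀ ω, f ω ≤ f' ω) : iidMean Q A f ≤ iidMean Q A' f' :=
  lintegral_mono fun ω => mul_le_mul'
    (Set.indicator_le_indicator_of_subset hA (fun _ => zero_le) ω) (hf ω)

lemma iidMean_add {A : Set (Path n X)} (hA : MeasurableSet A) {f f' : Path n X → ℝ≥0∞}
    (hf : Measurable f) :
    iidMean Q A (fun ω => f ω + f' ω) = iidMean Q A f + iidMean Q A f' := by
  simp_rw [iidMean, mul_add]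
  exact lintegral_add_left ((measurable_one.indicator hA).mul hf) _

lemma iidMean_const_mul {A : Set (Path n X)} (hA : MeasurableSet A) {f : Path n X → ℝ≥0∞}
    (hf : Measurable f) (c : ℝ≥0∞) :
    iidMean Q A (fun ω => c * f ω) = c * iidMean Q A f := by
  simp_rw [iidMean, mul_left_comm _ c]
  exact lintegral_const_mul _ ((measurable_one.indicator hA).mul hf)

lemma iidMean_le_one [IsProbabilityMeasure Q] {A : Set (Path n X)} {f : Path n X → ℝ≥0∞}
    (hf : ∀ ω, f ω ≤ 1) :
    iidMean Q A f ≤ 1 := by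
  calc iidMean Q A f ≤ ∫⁻ _, 1 ∂(Measure.infinitePi fun _ => Q) :=
        lintegral_mono fun ω => (mul_le_mul' (Set.indicator_le_self' (fun _ _ => zero_le) ω)
          (hf ω)).trans (by simp)
    _ = 1 := by simp

lemma iidMean_step [IsProbabilityMeasure Q] {t : ℕ} {A : Set (Path n X)}
    (hA : MeasurableSet[obsFiltration n X t] A)
    {s : Path n X → ℝ≥0} (hs : Measurable[obsFiltration n X t] s)
    {G : ℝ≥0 → (Fin n → X) → ℝ≥0∞} (hG : Measurable (Function.uncurry G)) :
    iidMean Q A (fun ω => G (s ω) (ω t)) = iidMean Q A fun ω => ∫⁻ y, G (s ω) y ∂Q :=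
  lintegral_infinitePi_adapted_mul (measurable_const.indicator hA) hs hG

/-- Telescoping the potential drift: nonnegativity of the potential permits shrinking `B t` to `B (t
+ 1)` and dropping the final term. -/
lemma log_mul_sum_push_le [IsProbabilityMeasure Q] {B : ℕ → Set (Path n X)}
    (hB : ∀ t, MeasurableSet[obsFiltration n X t] (B t)) (hBanti : Antitone B)
    (hL : Measurable L) (hL1 : ∫⁻ y, L y ∂Q = 1)
    (hkl : Integrable (fun y => InformationTheory.klFun (L y)) Q) {ℓ : ℝ} (hℓ : 0 ≤ ℓ) (M : ℕ) :
    ENNReal.ofReal ℓ * ∑ t ∈ Finset.range M, iidMean Q (B t) (fun ω => cusumPush L t ω) ≤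
      ENNReal.ofReal (Real.exp ℓ) + ENNReal.ofReal (∫ y, InformationTheory.klFun (L y) ∂Q) *
        ∑ t ∈ Finset.range M, iidMean Q (B t) (fun ω => cusum L t ω) := by
  set D := ENNReal.ofReal (∫ y, InformationTheory.klFun (L y) ∂Q)
  set b : ℕ → ℝ≥0∞ := fun t => iidMean Q (B t) (fun ω => cusumPush L t ω)
  set a : ℕ → ℝ≥0∞ :=
    fun t => iidMean Q (B t) (fun ω => ENNReal.ofReal (klPotential ℓ (cusum L t ω)))
  have hcm : ∀ t, Measurable (cusum L t : Path n X → ℝ≥0) := fun t =>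
    (measurable_cusum hL t).mono ((obsFiltration n X).le t) le_rfl
  have hpm : ∀ t, Measurable (cusumPush L t : Path n X → ℝ≥0) := fun t =>
    (measurable_cusumPush hL t).mono ((obsFiltration n X).le t) le_rfl
  have hBm : ∀ t, MeasurableSet (B t) := fun t => (obsFiltration n X).le t _ (hB t)
  have hhm := measurable_klPotential ℓ
  have hstep : ∀ t, a (t + 1) + ENNReal.ofReal ℓ * b (t + 1) ≤
      a t + D * iidMean Q (B t) (fun ω => cusum L t ω) := by
    intro t
    have hm : Measurable fun ω : Path n X =>
        ENNReal.ofReal (klPotential ℓ (cusum L (t + 1) ω)) :=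
      (hhm.comp (measurable_coe_nnreal_real.comp (hcm _))).ennreal_ofReal
    have hm' : Measurable fun ω : Path n X => (cusumPush L (t + 1) ω : ℝ≥0∞) :=
      measurable_coe_nnreal_ennreal.comp (hpm _)
    have hm0 : Measurable fun ω : Path n X => ENNReal.ofReal (klPotential ℓ (cusum L t ω)) :=
      (hhm.comp (measurable_coe_nnreal_real.comp (hcm _))).ennreal_ofReal
    rw [← iidMean_const_mul (hBm _) hm', ← iidMean_add (hBm _) hm,
      ← iidMean_const_mul (hBm _) (f := fun ω => (cusum L t ω : ℝ≥0∞))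
        (measurable_coe_nnreal_ennreal.comp (hcm t)),
      ← iidMean_add (hBm _) hm0]
    refine (iidMean_mono (hBanti t.le_succ) fun _ => le_rfl).trans ?_
    refine (iidMean_step (hB t) (measurable_cusum hL t) (G := fun s y =>
      ENNReal.ofReal (klPotential ℓ (max (s * L y) 1 : ℝ≥0)) +
        ENNReal.ofReal ℓ * (1 - s * L y : ℝ≥0)) ?_).le.trans ?_
    · simp only [Function.uncurry_def]
      have : Measurable fun p : ℝ≥0 × (Fin n → X) => p.1 * L p.2 := by fun_prop
      exact ((hhm.comp (measurable_coe_nnreal_real.comp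
        (this.max measurable_const))).ennreal_ofReal).add
        (measurable_const.mul (measurable_coe_nnreal_ennreal.comp (measurable_const.sub this)))
    · exact iidMean_mono subset_rfl fun ω =>
        lintegral_klPotential_step hL hL1 hkl hℓ (one_le_cusum L t ω)
  have hsum : ∀ M, a M + ENNReal.ofReal ℓ * ∑ t ∈ Finset.range M, b (t + 1) ≤
      a 0 + D * ∑ t ∈ Finset.range M, iidMean Q (B t) (fun ω => cusum L t ω) := by
    intro M
    induction M with
    | zero => simp
    | succ M ih =>
      rw [Finset.sum_range_succ, Finset.sum_range_succ, mul_add, mul_add]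
      calc _ = (a (M + 1) + ENNReal.ofReal ℓ * b (M + 1)) +
            ENNReal.ofReal ℓ * ∑ t ∈ Finset.range M, b (t + 1) := by ring
        _ ≤ _ := add_le_add_left (hstep M) _
        _ = (a M + ENNReal.ofReal ℓ * ∑ t ∈ Finset.range M, b (t + 1)) +
            D * iidMean Q (B M) (fun ω => cusum L M ω) := by ring
        _ ≤ _ := add_le_add_left ih _
        _ = _ := by ring
  -- The potential at the starting value `1` is `e^ℓ - 1 - ℓ`, leaving room for the cost `ℓ` of the
  -- initial push `b 0 ≤ 1`.
  have ha0 : a 0 + ENNReal.ofReal ℓ ≤ ENNReal.ofReal (Real.exp ℓ) := by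
    have h1 : a 0 ≤ ENNReal.ofReal (Real.exp ℓ - 1 - ℓ) := by
      have hc : ∀ ω : Path n X, ENNReal.ofReal (klPotential ℓ (cusum L 0 ω)) =
          ENNReal.ofReal (Real.exp ℓ - 1 - ℓ) * 1 := by
        intro ω
        simp only [cusum, klPotential, mul_one, NNReal.coe_one, Real.log_one]
        ring_nf
      simp only [a, hc]
      rw [iidMean_const_mul (hBm 0) measurable_const]
      exact mul_le_of_le_one_right' (iidMean_le_one fun _ => le_rfl)
    refine (add_le_add_left h1 _).trans ?_
    rw [← ENNReal.ofReal_add (by linarith [Real.add_one_le_exp ℓ]) hℓ]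
    exact ENNReal.ofReal_le_ofReal (by linarith)
  have hb0 : b 0 ≤ 1 := iidMean_le_one fun ω => by exact_mod_cast cusumPush_le_one L 0 ω
  calc
    _ ≤ ENNReal.ofReal ℓ * (∑ t ∈ Finset.range M, b (t + 1) + 1) := by
      gcongr
      calc ∑ t ∈ Finset.range M, b t ≤ ∑ t ∈ Finset.range (M + 1), b t :=
            Finset.sum_le_sum_of_subset (Finset.range_mono M.le_succ)
        _ ≤ _ := by rw [Finset.sum_range_succ']; gcongr
    _ ≤ ENNReal.ofReal ℓ + (a M + ENNReal.ofReal ℓ * ∑ t ∈ Finset.range M, b (t + 1)) := by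
      rw [mul_add, mul_one, add_comm]
      gcongr
      exact le_add_self
    _ ≤ ENNReal.ofReal ℓ + (a 0 + D * ∑ t ∈ Finset.range M,
          iidMean Q (B t) (fun ω => cusum L t ω)) :=
      add_le_add le_rfl (hsum M)
    _ = (a 0 + ENNReal.ofReal ℓ) + D * ∑ t ∈ Finset.range M,
          iidMean Q (B t) (fun ω => cusum L t ω) := by ring
    _ ≤ _ := by gcongr

/-- Without reflection the mean of the square root is multiplied by `∫ √L`, and reflection adds at
most the push. -/
lemma sum_sqrt_cusum_le [IsProbabilityMeasure Q] {B : ℕ → Set (Path n X)}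
    (hB : ∀ t, MeasurableSet[obsFiltration n X t] (B t)) (hBanti : Antitone B)
    (hL : Measurable L) (M : ℕ) :
    ∑ t ∈ Finset.range M, iidMean Q (B t) (fun ω => (NNReal.sqrt (cusum L t ω) : ℝ≥0)) ≤
      (∫⁻ y, (NNReal.sqrt (L y) : ℝ≥0) ∂Q) * ∑ t ∈ Finset.range M,
          iidMean Q (B t) (fun ω => (NNReal.sqrt (cusum L t ω) : ℝ≥0)) +
        ∑ t ∈ Finset.range M, iidMean Q (B t) (fun ω => cusumPush L t ω) := by
  set ρ := ∫⁻ y, (NNReal.sqrt (L y) : ℝ≥0∞) ∂Q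
  set r : ℕ → ℝ≥0∞ := fun t => iidMean Q (B t) (fun ω => (NNReal.sqrt (cusum L t ω) : ℝ≥0))
  set b : ℕ → ℝ≥0∞ := fun t => iidMean Q (B t) (fun ω => cusumPush L t ω)
  have hcm : ∀ t, Measurable (cusum L t : Path n X → ℝ≥0) := fun t =>
    (measurable_cusum hL t).mono ((obsFiltration n X).le t) le_rfl
  have hBm : ∀ t, MeasurableSet (B t) := fun t => (obsFiltration n X).le t _ (hB t)
  have hstep : ∀ t, r (t + 1) ≤ ρ * r t + b (t + 1) := by
    intro t
    have hLt : Measurable fun ω : Path n X => L (ω t) := hL.comp (measurable_pi_apply t)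
    have hm : Measurable fun ω : Path n X =>
        ((NNReal.sqrt (cusum L t ω * L (ω t)) : ℝ≥0) : ℝ≥0∞) :=
      measurable_coe_nnreal_ennreal.comp
        (NNReal.continuous_sqrt.measurable.comp ((hcm t).mul hLt))
    calc r (t + 1) ≤ iidMean Q (B (t + 1)) (fun ω =>
          ((NNReal.sqrt (cusum L t ω * L (ω t)) : ℝ≥0) : ℝ≥0∞) + cusumPush L (t + 1) ω) :=
        iidMean_mono subset_rfl fun ω => by
          exact_mod_cast sqrt_max_one_le (cusum L t ω * L (ω t))
      _ = iidMean Q (B (t + 1)) (fun ω =>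
          ((NNReal.sqrt (cusum L t ω * L (ω t)) : ℝ≥0) : ℝ≥0∞)) + b (t + 1) :=
        iidMean_add (hBm _) hm
      _ ≤ iidMean Q (B t) (fun ω =>
          ((NNReal.sqrt (cusum L t ω * L (ω t)) : ℝ≥0) : ℝ≥0∞)) + b (t + 1) := by
        gcongr
        exact iidMean_mono (hBanti t.le_succ) fun _ => le_rfl
      _ = ρ * r t + b (t + 1) := by
        congr 1
        rw [iidMean_step (hB t) (measurable_cusum hL t) (G := fun s y =>
          ((NNReal.sqrt (s * L y) : ℝ≥0) : ℝ≥0∞)), ← iidMean_const_mul (hBm t)]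
        · congr 1
          ext1 ω
          simp_rw [NNReal.sqrt_mul, ENNReal.coe_mul]
          rw [lintegral_const_mul, mul_comm]
          exact measurable_coe_nnreal_ennreal.comp (NNReal.continuous_sqrt.measurable.comp hL)
        · exact measurable_coe_nnreal_ennreal.comp
            (NNReal.continuous_sqrt.measurable.comp (hcm t))
        · simp only [Function.uncurry_def]
          have : Measurable fun p : ℝ≥0 × (Fin n → X) => p.1 * L p.2 := by fun_prop
          exact measurable_coe_nnreal_ennreal.comp (NNReal.continuous_sqrt.measurable.comp this)
  cases M with
  | zero => simp
  | succ M =>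
    have h0 : r 0 = b 0 := by simp [r, b, cusum, cusumPush]
    calc ∑ t ∈ Finset.range (M + 1), r t = ∑ t ∈ Finset.range M, r (t + 1) + r 0 :=
          Finset.sum_range_succ' _ _
      _ ≤ ∑ t ∈ Finset.range M, (ρ * r t + b (t + 1)) + b 0 := by
        rw [h0]
        gcongr with t
        exact hstep t
      _ = ρ * ∑ t ∈ Finset.range M, r t + ∑ t ∈ Finset.range (M + 1), b t := by
        rw [Finset.sum_add_distrib, ← Finset.mul_sum, add_assoc, ← Finset.sum_range_succ']
      _ ≤ _ := by
        gcongr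
        exact M.le_succ

end Sums

end Lorden

/-! ### Label sets and mixtures -/

section Mixture

variable {X : Type*} [MeasurableSpace X] {n K : ℕ} {m : Fin K → ℕ}

lemma sum_groupSize (hm : ∀ k, 1 ≤ m k) (hn : ∑ k, m k = n) (s : Option (Fin K)) :
    ∑ g, groupSize m s g = n := by
  rw [Fintype.sum_sum_type, ← hn]
  cases s with
  | none => simp [groupSize]
  | some k =>
    simp only [groupSize]
    rw [← Finset.sum_add_distrib]
    refine Finset.sum_congr rfl fun j _ => ?_
    have := hm j
    split_ifs <;> omega

lemma labels_nonempty (hm : ∀ k, 1 ≤ m k) (hn : ∑ k, m k = n) (s : Option (Fin K)) :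
    (labels n m s).Nonempty := by
  have hcard : Fintype.card (Fin n) = Fintype.card (Σ g, Fin (groupSize m s g)) := by
    simp [sum_groupSize hm hn s]
  let e := Fintype.equivOfCardEq hcard
  refine ⟨fun i => (e i).1, ?_⟩
  simp only [labels, Finset.mem_filter, Finset.mem_univ, true_and]
  intro g
  rw [← Fintype.card_subtype]
  have := Fintype.card_congr ((e.subtypeEquiv (p := fun i => (e i).1 = g) (q := fun x => x.1 = g)
    fun _ => Iff.rfl).trans (Equiv.sigmaSubtype g))
  simpa using this

variable (p₀ p₁ : Fin K → Measure X) [∀ k, IsProbabilityMeasure (p₀ k)]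
  [∀ k, IsProbabilityMeasure (p₁ k)]

instance isProbabilityMeasure_sumElim (g : Group K) :
    IsProbabilityMeasure (Sum.elim p₀ p₁ g) := by
  cases g <;> simp only [Sum.elim_inl, Sum.elim_inr] <;> infer_instance

instance isProbabilityMeasure_vectorLaw (σ : Fin n → Group K) :
    IsProbabilityMeasure (vectorLaw p₀ p₁ σ) := by
  unfold vectorLaw; infer_instance

instance isProbabilityMeasure_pathLaw (Ω : ℕ → Fin n → Group K) :
    IsProbabilityMeasure (pathLaw p₀ p₁ Ω) := by
  unfold pathLaw; infer_instance

lemma isProbabilityMeasure_mixture (hm : ∀ k, 1 ≤ m k) (hn : ∑ k, m k = n)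
    (s : Option (Fin K)) : IsProbabilityMeasure (mixture n m p₀ p₁ s) := by
  refine ⟨?_⟩
  have := (labels_nonempty hm hn s).card_pos.ne'
  simp only [mixture, Measure.smul_apply, Measure.finsetSum_apply, measure_univ,
    Finset.sum_const, nsmul_eq_mul, mul_one, smul_eq_mul]
  exact ENNReal.inv_mul_cancel (by exact_mod_cast this) (by simp)

/-- The sum of the one-sample marginals is the same for every label, since it depends only on the
group sizes. -/
lemma sum_mixture_eval (hm : ∀ k, 1 ≤ m k) (hn : ∑ k, m k = n) (s : Option (Fin K))
    {A : Set X} (hA : MeasurableSet A) :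
    ∑ i : Fin n, mixture n m p₀ p₁ s (Function.eval i ⁻¹' A) =
      ∑ g, (groupSize m s g : ℝ≥0∞) * Sum.elim p₀ p₁ g A := by
  have h : ∀ σ ∈ labels n m s, ∑ i : Fin n, vectorLaw p₀ p₁ σ (Function.eval i ⁻¹' A) =
      ∑ g, (groupSize m s g : ℝ≥0∞) * Sum.elim p₀ p₁ g A := by
    intro σ hσ
    simp only [labels, Finset.mem_filter, Finset.mem_univ, true_and] at hσ
    have h1 : ∀ i, vectorLaw p₀ p₁ σ (Function.eval i ⁻¹' A) = Sum.elim p₀ p₁ (σ i) A := fun i =>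
      (measurePreserving_eval (fun i => Sum.elim p₀ p₁ (σ i)) i).measure_preimage
        hA.nullMeasurableSet
    simp_rw [h1]
    rw [← Finset.sum_fiberwise Finset.univ σ]
    refine Finset.sum_congr rfl fun g _ => ?_
    rw [Finset.sum_congr rfl fun i hi => by rw [(Finset.mem_filter.mp hi).2], Finset.sum_const,
      hσ g, nsmul_eq_mul]
  have hc := (labels_nonempty hm hn s).card_pos.ne'
  simp only [mixture, Measure.smul_apply, Measure.finsetSum_apply, smul_eq_mul]
  rw [← Finset.mul_sum, Finset.sum_comm, Finset.sum_congr rfl h, Finset.sum_const, nsmul_eq_mul,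
    ← mul_assoc, ENNReal.inv_mul_cancel (by exact_mod_cast hc) (by simp), one_mul]

/-- The sums of marginals of the two mixtures differ by `p₁ k - p₀ k`. -/
lemma mixture_ne (hm : ∀ k, 1 ≤ m k) (hn : ∑ k, m k = n) (k : Fin K) (hp : p₁ k ≠ p₀ k) :
    mixture n m p₀ p₁ (some k) ≠ mixture n m p₀ p₁ none := by
  intro heq
  refine hp (Measure.ext fun A hA => ?_)
  have h1 := sum_mixture_eval p₀ p₁ hm hn (some k) hA
  rw [heq, sum_mixture_eval p₀ p₁ hm hn none hA] at h1
  simp only [Fintype.sum_sum_type, groupSize, Sum.elim_inl, Sum.elim_inr, Nat.cast_zero, zero_mul,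
    Finset.sum_const_zero, add_zero, Nat.cast_ite, Nat.cast_one, ite_mul, one_mul,
    Finset.sum_ite_eq', Finset.mem_univ, if_true] at h1
  have h2 : ∑ j, (m j : ℝ≥0∞) * p₀ j A =
      (∑ j, if j = k then ((m j - 1 : ℕ) : ℝ≥0∞) * p₀ j A else (m j : ℝ≥0∞) * p₀ j A) +
        p₀ k A := by
    have : p₀ k A = ∑ j, if j = k then p₀ j A else 0 := by simp
    rw [this, ← Finset.sum_add_distrib]
    refine Finset.sum_congr rfl fun j _ => ?_
    split_ifs
    · obtain ⟨c, hc⟩ := Nat.exists_eq_add_of_le (hm j)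
      rw [hc, Nat.add_sub_cancel_left]
      push_cast
      ring
    · rw [add_zero]
  rw [h2] at h1
  refine ((ENNReal.add_right_inj ?_).mp h1).symm
  refine (ENNReal.sum_lt_top.mpr fun j _ => ?_).ne
  split_ifs <;> exact ENNReal.mul_lt_top (ENNReal.natCast_lt_top _) (measure_lt_top _ _)

end Mixture

/-! ### Between random and deterministic labels -/

section Derandomize

variable {X : Type*} [MeasurableSpace X] {n K : ℕ} {m : Fin K → ℕ}
  (p₀ p₁ : Fin K → Measure X)

/-- The laws of the sample vectors when the labels at the first `j` times are random and those
at later times are given by `Ω`. -/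
def mixedThenLabeled (m : Fin K → ℕ) (s : ℕ → Option (Fin K)) (Ω : ℕ → Fin n → Group K) (j i : ℕ) :
    Measure (Fin n → X) :=
  if i < j then mixture n m p₀ p₁ (s i) else vectorLaw p₀ p₁ (Ω i)

/-- The laws of the sample vectors when the labels at the first `j` times are given by `Ω` and
those at later times are random. -/
def labeledThenMixed (m : Fin K → ℕ) (s : ℕ → Option (Fin K)) (Ω : ℕ → Fin n → Group K) (j i : ℕ) :
    Measure (Fin n → X) :=
  if i < j then vectorLaw p₀ p₁ (Ω i) else mixture n m p₀ p₁ (s i)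

variable [∀ k, IsProbabilityMeasure (p₀ k)] [∀ k, IsProbabilityMeasure (p₁ k)]

lemma lintegral_infinitePi_update_labels (s : Option (Fin K))
    [IsProbabilityMeasure (mixture n m p₀ p₁ s)] (μ : ℕ → Measure (Fin n → X))
    [∀ i, IsProbabilityMeasure (μ i)] (j : ℕ) {f : Path n X → ℝ≥0∞} (hf : Measurable f) :
    ∫⁻ ω, f ω ∂(Measure.infinitePi (Function.update μ j (mixture n m p₀ p₁ s))) =
      ((labels n m s).card : ℝ≥0∞)⁻¹ * ∑ σ ∈ labels n m s,
        ∫⁻ ω, f ω ∂(Measure.infinitePi (Function.update μ j (vectorLaw p₀ p₁ σ))) :=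
  lintegral_infinitePi_update_mixture μ j (labels n m s) (vectorLaw p₀ p₁) _
    (mixture n m p₀ p₁ s) rfl hf

/-- Averaging over the labels at the times before `M`. -/
lemma lintegral_mixture_le_of_labels (hm : ∀ k, 1 ≤ m k) (hn : ∑ k, m k = n)
    (s : ℕ → Option (Fin K)) [∀ i, IsProbabilityMeasure (mixture n m p₀ p₁ (s i))] {M : ℕ}
    {f h : Path n X → ℝ≥0∞} (hf : Measurable[obsFiltration n X M] f)
    (hh : Measurable[obsFiltration n X M] h)
    (hle : ∀ Ω : ℕ → Fin n → Group K, (∀ i, Ω i ∈ labels n m (s i)) →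
      ∫⁻ ω, f ω ∂(pathLaw p₀ p₁ Ω) ≤ ∫⁻ ω, h ω ∂(pathLaw p₀ p₁ Ω)) :
    ∫⁻ ω, f ω ∂(Measure.infinitePi fun i => mixture n m p₀ p₁ (s i)) ≤
      ∫⁻ ω, h ω ∂(Measure.infinitePi fun i => mixture n m p₀ p₁ (s i)) := by
  have inst : ∀ Ω j i, IsProbabilityMeasure
      (mixedThenLabeled p₀ p₁ m s (Ω : ℕ → Fin n → Group K) j i) := by
    intro Ω j i; unfold mixedThenLabeled; split_ifs <;> infer_instance
  have hf' := hf.mono ((obsFiltration n X).le M) le_rfl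
  have hh' := hh.mono ((obsFiltration n X).le M) le_rfl
  have key : ∀ j, ∀ Ω : ℕ → Fin n → Group K, (∀ i, Ω i ∈ labels n m (s i)) →
      ∫⁻ ω, f ω ∂(Measure.infinitePi (mixedThenLabeled p₀ p₁ m s Ω j)) ≤
        ∫⁻ ω, h ω ∂(Measure.infinitePi (mixedThenLabeled p₀ p₁ m s Ω j)) := by
    intro j
    induction j with
    | zero =>
      intro Ω hΩ
      have h0 : mixedThenLabeled p₀ p₁ m s Ω 0 = fun i => vectorLaw p₀ p₁ (Ω i) := by
        ext1 i; simp [mixedThenLabeled]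
      rw [h0]
      exact hle Ω hΩ
    | succ j ih =>
      intro Ω hΩ
      have hup : mixedThenLabeled p₀ p₁ m s Ω (j + 1) =
          Function.update (mixedThenLabeled p₀ p₁ m s Ω j) j (mixture n m p₀ p₁ (s j)) := by
        ext1 i
        rcases lt_trichotomy i j with h | h | h
        · simp [mixedThenLabeled, h.ne, h, Nat.lt_succ_of_lt h]
        · subst h; simp [mixedThenLabeled]
        · simp [mixedThenLabeled, h.ne', not_lt.mpr h.le, not_lt.mpr (Nat.succ_le_of_lt h)]
      -- Randomizing label `j` averages the previous inequality over admissible sequences that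
      -- differ at `j`; hence the induction quantifies over all `Ω`.
      have hup' : ∀ σ, Function.update (mixedThenLabeled p₀ p₁ m s Ω j) j (vectorLaw p₀ p₁ σ) =
          mixedThenLabeled p₀ p₁ m s (Function.update Ω j σ) j := by
        intro σ
        ext1 i
        by_cases h : i = j
        · subst h; simp [mixedThenLabeled]
        · simp [mixedThenLabeled, h]
      rw [hup, lintegral_infinitePi_update_labels p₀ p₁ _ _ j hf',
        lintegral_infinitePi_update_labels p₀ p₁ _ _ j hh']
      refine mul_le_mul_right (Finset.sum_le_sum fun σ hσ => ?_) _
      rw [hup' σ]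
      refine ih _ fun i => ?_
      by_cases h : i = j
      · subst h; simpa using hσ
      · simpa [h] using hΩ i
  choose Ω hΩ using fun i => labels_nonempty hm hn (s i)
  have hagree : ∀ i < M, mixture n m p₀ p₁ (s i) = mixedThenLabeled p₀ p₁ m s Ω M i :=
    fun i hi => by simp [mixedThenLabeled, hi]
  rw [lintegral_infinitePi_congr hagree hf, lintegral_infinitePi_congr hagree hh]
  exact key M Ω hΩ

/-- Some sequence of labels does not exceed the average over random labels. -/
lemma exists_labels_lintegral_le (hm : ∀ k, 1 ≤ m k) (hn : ∑ k, m k = n)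
    (s : ℕ → Option (Fin K)) [∀ i, IsProbabilityMeasure (mixture n m p₀ p₁ (s i))]
    {f : ℕ → Path n X → ℝ≥0∞} (hf : ∀ t, Measurable[obsFiltration n X t] (f t)) :
    ∃ Ω : ℕ → Fin n → Group K, (∀ i, Ω i ∈ labels n m (s i)) ∧
      ∫⁻ ω, ∑' t, f t ω ∂(pathLaw p₀ p₁ Ω) ≤
        ∫⁻ ω, ∑' t, f t ω ∂(Measure.infinitePi fun i => mixture n m p₀ p₁ (s i)) := by
  have inst : ∀ Ω j i, IsProbabilityMeasure
      (labeledThenMixed p₀ p₁ m s (Ω : ℕ → Fin n → Group K) j i) := by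
    intro Ω j i; unfold labeledThenMixed; split_ifs <;> infer_instance
  have hf' : ∀ t, Measurable (f t) := fun t => (hf t).mono ((obsFiltration n X).le t) le_rfl
  have hF : Measurable fun ω => ∑' t, f t ω := Measurable.tsum hf'
  have hstep : ∀ Ω : ℕ → Fin n → Group K, ∀ j, ∃ σ ∈ labels n m (s j),
      ∫⁻ ω, ∑' t, f t ω ∂(Measure.infinitePi
        (labeledThenMixed p₀ p₁ m s (Function.update Ω j σ) (j + 1))) ≤
      ∫⁻ ω, ∑' t, f t ω ∂(Measure.infinitePi (labeledThenMixed p₀ p₁ m s Ω j)) := by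
    intro Ω j
    have hne := labels_nonempty hm hn (s j)
    have hup : ∀ σ, labeledThenMixed p₀ p₁ m s (Function.update Ω j σ) (j + 1) =
        Function.update (labeledThenMixed p₀ p₁ m s Ω j) j (vectorLaw p₀ p₁ σ) := by
      intro σ
      ext1 i
      rcases lt_trichotomy i j with h | h | h
      · simp [labeledThenMixed, h.ne, h, Nat.lt_succ_of_lt h]
      · subst h; simp [labeledThenMixed]
      · simp [labeledThenMixed, h.ne', not_lt.mpr h.le, not_lt.mpr (Nat.succ_le_of_lt h)]
    have hself : labeledThenMixed p₀ p₁ m s Ω j =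
        Function.update (labeledThenMixed p₀ p₁ m s Ω j) j (mixture n m p₀ p₁ (s j)) := by
      rw [eq_comm, Function.update_eq_self_iff]
      simp [labeledThenMixed]
    -- Greedy choice: the best label at time `j` does no worse than the average.
    obtain ⟨σ, hσ, hmin⟩ := Finset.exists_min_image (labels n m (s j)) (fun σ =>
      ∫⁻ ω, ∑' t, f t ω ∂(Measure.infinitePi (Function.update
        (labeledThenMixed p₀ p₁ m s Ω j) j (vectorLaw p₀ p₁ σ)))) hne
    refine ⟨σ, hσ, ?_⟩
    rw [hup]
    conv_rhs => rw [hself, lintegral_infinitePi_update_labels p₀ p₁ _ _ j hF]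
    refine le_trans ?_ (mul_le_mul_right (Finset.card_nsmul_le_sum _ _ _ hmin) _)
    rw [nsmul_eq_mul, ← mul_assoc, ENNReal.inv_mul_cancel
      (by exact_mod_cast hne.card_pos.ne') (by simp), one_mul]
  choose next hnext hnext_le using hstep
  choose Ω₀ hΩ₀ using fun i => labels_nonempty hm hn (s i)
  let G : ℕ → ℕ → Fin n → Group K := fun j =>
    Nat.rec Ω₀ (fun j Ω => Function.update Ω j (next Ω j)) j
  have hG : ∀ j, G (j + 1) = Function.update (G j) j (next (G j) j) := fun _ => rfl
  have hGval : ∀ j i, G j i ∈ labels n m (s i) := by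
    intro j
    induction j with
    | zero => exact hΩ₀
    | succ j ih =>
      intro i
      rw [hG]
      by_cases h : i = j
      · subst h; simpa using hnext _ _
      · simpa [h] using ih i
  have hGstab : ∀ i j, i < j → G j i = G (i + 1) i := by
    intro i j hij
    induction j, hij using Nat.le_induction with
    | base => rfl
    | succ j hij ih => rw [hG, Function.update_of_ne (by omega), ih]
  have hGle : ∀ j, ∫⁻ ω, ∑' t, f t ω ∂(Measure.infinitePi (labeledThenMixed p₀ p₁ m s (G j) j)) ≤
      ∫⁻ ω, ∑' t, f t ω ∂(Measure.infinitePi fun i => mixture n m p₀ p₁ (s i)) := by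
    intro j
    induction j with
    | zero =>
      have h0 : labeledThenMixed p₀ p₁ m s (G 0) 0 = fun i => mixture n m p₀ p₁ (s i) := by
        ext1 i; simp [labeledThenMixed]
      rw [h0]
    | succ j ih => exact (hnext_le _ _).trans ih
  refine ⟨fun i => G (i + 1) i, fun i => hGval (i + 1) i, ?_⟩
  -- The full sum need not depend on finitely many coordinates, but its partial sums do; on these
  -- the limiting labels agree with `G M`.
  rw [lintegral_tsum fun t => (hf' t).aemeasurable]
  refine ENNReal.tsum_le_of_sum_range_le fun M => ?_
  calc ∑ t ∈ Finset.range M, ∫⁻ ω, f t ω ∂(pathLaw p₀ p₁ fun i => G (i + 1) i)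
      = ∑ t ∈ Finset.range M,
          ∫⁻ ω, f t ω ∂(Measure.infinitePi (labeledThenMixed p₀ p₁ m s (G M) M)) := by
        refine Finset.sum_congr rfl fun t ht => ?_
        refine lintegral_infinitePi_congr (fun i hi => ?_) (hf t)
        have hiM : i < M := hi.trans (Finset.mem_range.mp ht)
        simp [labeledThenMixed, hiM, hGstab i M hiM]
    _ = ∫⁻ ω, ∑ t ∈ Finset.range M, f t ω
          ∂(Measure.infinitePi (labeledThenMixed p₀ p₁ m s (G M) M)) :=
        (lintegral_finsetSum _ fun t _ => hf' t).symm
    _ ≤ ∫⁻ ω, ∑' t, f t ω ∂(Measure.infinitePi (labeledThenMixed p₀ p₁ m s (G M) M)) :=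
        lintegral_mono fun ω => ENNReal.sum_le_tsum _
    _ ≤ _ := hGle M

end Derandomize

/-- Integrate `2√x ≤ 1 + x`, which is an equality only at `x = 1`. -/
lemma lintegral_sqrt_lt_one {Y : Type*} [MeasurableSpace Y] {Q : Measure Y}
    [IsProbabilityMeasure Q] {L : Y → ℝ≥0} (hL : Measurable L) (hL1 : ∫⁻ y, L y ∂Q = 1)
    (hne : ¬ L =ᵐ[Q] 1) : ∫⁻ y, (NNReal.sqrt (L y) : ℝ≥0) ∂Q < 1 := by
  have hpt : ∀ x : ℝ≥0, 2 * NNReal.sqrt x ≤ 1 + x := by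
    intro x
    rw [← NNReal.coe_le_coe]
    push_cast
    nlinarith [sq_nonneg (Real.sqrt x - 1), Real.sq_sqrt x.coe_nonneg]
  have hm : Measurable fun y => ((NNReal.sqrt (L y) : ℝ≥0) : ℝ≥0∞) :=
    measurable_coe_nnreal_ennreal.comp (NNReal.continuous_sqrt.measurable.comp hL)
  have hsum : ∫⁻ y, (1 + L y : ℝ≥0∞) ∂Q = 2 := by
    rw [lintegral_add_left measurable_const, hL1, lintegral_one, measure_univ, one_add_one_eq_two]
  have hle : ∀ y, 2 * ((NNReal.sqrt (L y) : ℝ≥0) : ℝ≥0∞) ≤ 1 + L y := fun y => by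
    exact_mod_cast hpt (L y)
  by_contra! hge
  refine hne ?_
  have hae := ae_eq_of_ae_le_of_lintegral_le (μ := Q) (ae_of_all _ hle)
    (((lintegral_mono hle).trans hsum.le).trans_lt (by simp)).ne (by fun_prop) (by
      rw [hsum, lintegral_const_mul _ hm]
      calc (2 : ℝ≥0∞) = 2 * 1 := (mul_one _).symm
        _ ≤ _ := by gcongr)
  filter_upwards [hae] with y hy
  have h2 : 2 * NNReal.sqrt (L y) = 1 + L y := by exact_mod_cast hy
  rw [← NNReal.coe_inj] at h2
  push_cast at h2
  have h3 := Real.sq_sqrt (L y).coe_nonneg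
  have h4 : Real.sqrt (L y) = 1 := by
    have : (Real.sqrt (L y) - 1) ^ 2 = 0 := by linarith
    linarith [pow_eq_zero_iff two_ne_zero |>.mp this]
  rw [h4] at h3
  simp only [Pi.one_apply]
  rw [← NNReal.coe_inj]
  simpa using h3.symm

/-! ### Stopping times and conditional delay -/

section Delay

variable {X : Type*} [MeasurableSpace X] {n K : ℕ} {m : Fin K → ℕ}
  {p₀ p₁ : Fin K → Measure X} {τ : Path n X → ℕ∞}

lemma measurableSet_lt_stoppingTime (hτ : IsStoppingTime (obsFiltration n X) τ) (t : ℕ) :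
    MeasurableSet[obsFiltration n X t] {ω | (t : ℕ∞) < τ ω} :=
  hτ.measurableSet_gt t

lemma enat_eq_tsum_indicator (a : ℕ∞) :
    (a : ℝ≥0∞) = ∑' t : ℕ, if (t : ℕ∞) < a then 1 else 0 := by
  induction a using ENat.recTopCoe with
  | top => simp
  | coe a =>
    simp only [Nat.cast_lt, ENat.toENNReal_coe]
    rw [tsum_eq_sum (s := Finset.range a) fun t ht => by
      rw [if_neg]; simpa using ht]
    rw [Finset.sum_congr rfl fun t ht => if_pos (Finset.mem_range.mp ht)]
    simp

lemma sum_indicator_le_tsub (a : ℕ∞) (c M : ℕ) :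
    ∑ t ∈ Finset.Ico c M, (if (t : ℕ∞) < a then (1 : ℝ≥0∞) else 0) ≤ ((a - c : ℕ∞) : ℝ≥0∞) := by
  induction a using ENat.recTopCoe with
  | top => simp
  | coe a =>
    rw [Finset.sum_ite, Finset.sum_const_zero, add_zero, Finset.sum_const, nsmul_one]
    have : ((Finset.Ico c M).filter fun t : ℕ => (t : ℕ∞) < a).card ≤ a - c := by
      rw [← Nat.card_Ico]
      refine Finset.card_le_card fun t ht => ?_
      simp only [Finset.mem_filter, Finset.mem_Ico, Nat.cast_lt] at ht ⊢
      exact ⟨ht.1.1, ht.2⟩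
    rw [← ENat.natCast_sub, ENat.toENNReal_coe]
    exact_mod_cast this

lemma measurable_stoppingTime_tsub (hτ : IsStoppingTime (obsFiltration n X) τ) (c : ℕ∞) :
    Measurable fun ω => ((τ ω - c : ℕ∞) : ℝ≥0∞) := by
  have hm : Measurable τ :=
    ENat.measurable_iff.mpr fun t => (obsFiltration n X).le t _ (hτ.measurableSet_eq t)
  exact (measurable_from_top (f := fun a : ℕ∞ => ((a - c : ℕ∞) : ℝ≥0∞))).comp hm

lemma lintegral_mul_delay_le [∀ k, IsProbabilityMeasure (p₀ k)] [∀ k, IsProbabilityMeasure (p₁ k)]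
    (hτ : IsStoppingTime (obsFiltration n X) τ) (k : Fin K) (a : ℕ)
    {Ω : ℕ → Fin n → Group K} (hΩ : ∀ i, Ω i ∈ labels n m (staticTrajectory k (a + 1) i))
    {g : Path n X → ℝ≥0∞} (hg : Measurable[obsFiltration n X a] g) :
    ∫⁻ ω, g ω * ((τ ω - ((a + 1 : ℕ) : ℕ∞) : ℕ∞) : ℝ≥0∞) ∂(pathLaw p₀ p₁ Ω) ≤
      WADD m p₀ p₁ τ * ∫⁻ ω, g ω ∂(pathLaw p₀ p₁ Ω) := by
  set P := pathLaw p₀ p₁ Ω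
  set Z : Path n X → ℝ≥0∞ := fun ω => ((τ ω - ((a + 1 : ℕ) : ℕ∞) : ℕ∞) : ℝ≥0∞)
  have hZ : Measurable Z := measurable_stoppingTime_tsub hτ _
  have hle := (obsFiltration n X).le a
  have hg' := hg.mono hle le_rfl
  have hess : essSup (condLExp (obsFiltration n X a) P Z) P ≤ WADD m p₀ p₁ τ := by
    unfold WADD
    exact le_iSup_of_le (a + 1) <| le_iSup_of_le (by omega) <| le_iSup_of_le k <|
      le_iSup_of_le Ω <| le_iSup_of_le hΩ le_rfl
  -- The bound on the conditional expectation becomes an inequality of measures on level `a`, which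
  -- can then be tested against any nonnegative `g` of that level.
  have hmeas : (P.withDensity Z).trim hle ≤ (WADD m p₀ p₁ τ • P).trim hle := by
    refine @Measure.le_intro _ (obsFiltration n X a) _ _ fun s hs _ => ?_
    rw [trim_measurableSet_eq hle hs, trim_measurableSet_eq hle hs, withDensity_apply _ (hle s hs),
      ← setLIntegral_condLExp hle P Z hs, Measure.smul_apply, smul_eq_mul, ← setLIntegral_const]
    refine setLIntegral_mono_ae measurable_const.aemeasurable ?_
    filter_upwards [ENNReal.ae_le_essSup (μ := P) (condLExp (obsFiltration n X a) P Z)]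
      with ω hω _ using hω.trans hess
  calc ∫⁻ ω, g ω * Z ω ∂P = ∫⁻ ω, g ω ∂(P.withDensity Z) := by
        rw [lintegral_withDensity_eq_lintegral_mul _ hZ hg']
        simp [mul_comm]
    _ = ∫⁻ ω, g ω ∂(P.withDensity Z).trim hle := (lintegral_trim hle hg).symm
    _ ≤ ∫⁻ ω, g ω ∂(WADD m p₀ p₁ τ • P).trim hle := lintegral_mono' hmeas le_rfl
    _ = _ := by rw [lintegral_trim hle hg, lintegral_smul_measure, smul_eq_mul]

end Delay

/-! ### Combining the three inequalities -/

section Main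

variable {X : Type*} [MeasurableSpace X] {n K : ℕ} {m : Fin K → ℕ}
  {p₀ p₁ : Fin K → Measure X} {τ : Path n X → ℕ∞}

lemma mixture_staticTrajectory (k : Fin K) (a i : ℕ) :
    mixture n m p₀ p₁ (staticTrajectory k (a + 1) i) =
      if i < a then mixture n m p₀ p₁ none else mixture n m p₀ p₁ (some k) := by
  simp only [staticTrajectory, Nat.add_lt_add_iff_right]
  split_ifs <;> rfl

variable [∀ k, IsProbabilityMeasure (p₀ k)] [∀ k, IsProbabilityMeasure (p₁ k)]

/-- The products of `L` turn `Q` into the law with change point `ν = a + 1`. The terms `t > a` count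
at most `(τ - ν)⁺`; the term `t = a` is the `+ 1`. -/
lemma sum_delay_le (hm : ∀ k, 1 ≤ m k) (hn : ∑ k, m k = n)
    (hτ : IsStoppingTime (obsFiltration n X) τ) (k : Fin K) {L : (Fin n → X) → ℝ≥0}
    (hL : Measurable L) (hP : mixture n m p₀ p₁ (some k) =
      (mixture n m p₀ p₁ none).withDensity fun y => (L y : ℝ≥0∞)) {a M : ℕ} (haM : a < M)
    {g : Path n X → ℝ≥0∞} (hg : Measurable[obsFiltration n X a] g) :
    ∑ t ∈ Finset.Ico a M, iidMean (mixture n m p₀ p₁ none) {ω | (t : ℕ∞) < τ ω}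
        (fun ω => g ω * ∏ i ∈ Finset.Ico a t, (L (ω i) : ℝ≥0∞)) ≤
      (WADD m p₀ p₁ τ + 1) *
        iidMean (mixture n m p₀ p₁ none) {ω | (a : ℕ∞) < τ ω} g := by
  have instM := isProbabilityMeasure_mixture p₀ p₁ hm hn
  set Q := mixture n m p₀ p₁ none
  set B : ℕ → Set (Path n X) := fun t => {ω | (t : ℕ∞) < τ ω}
  have hB : ∀ t, MeasurableSet[obsFiltration n X t] (B t) := measurableSet_lt_stoppingTime hτ
  set μ : ℕ → Measure (Fin n → X) := fun i => mixture n m p₀ p₁ (staticTrajectory k (a + 1) i)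
  have instμ : ∀ i, IsProbabilityMeasure (μ i) := fun i => instM _
  have hμ : ∀ i, μ i = if i < a then Q else mixture n m p₀ p₁ (some k) :=
    mixture_staticTrajectory k a
  have hmono : ∀ {s t : ℕ} {f : Path n X → ℝ≥0∞}, s ≤ t → Measurable[obsFiltration n X s] f →
      Measurable[obsFiltration n X t] f := fun hst hf =>
    hf.mono ((obsFiltration n X).mono hst) le_rfl
  have hBg : ∀ t, a ≤ t → Measurable[obsFiltration n X t] fun ω => (B t).indicator 1 ω * g ω :=
    fun t hat => (measurable_const.indicator (hB t)).mul (hmono hat hg)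
  have hchange : ∀ t, a ≤ t →
      iidMean Q (B t) (fun ω => g ω * ∏ i ∈ Finset.Ico a t, (L (ω i) : ℝ≥0∞)) =
        ∫⁻ ω, (B t).indicator 1 ω * g ω ∂(Measure.infinitePi μ) := by
    intro t hat
    rw [lintegral_infinitePi_change hL hP μ hat (fun i _ => hμ i) (hBg t hat)]
    simp only [iidMean, mul_assoc]
  have hle : ∫⁻ ω, ∑ t ∈ Finset.Ico (a + 1) M, (B t).indicator 1 ω * g ω
        ∂(Measure.infinitePi μ) ≤
      ∫⁻ ω, WADD m p₀ p₁ τ * ((B a).indicator 1 ω * g ω) ∂(Measure.infinitePi μ) := by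
    refine lintegral_mixture_le_of_labels p₀ p₁ hm hn (staticTrajectory k (a + 1)) (M := M)
      ?_ ?_ fun Ω hΩ => ?_
    · exact @Finset.measurable_fun_sum _ _ _ _ _ _ (obsFiltration n X M) _ _ fun t ht =>
        hmono (Finset.mem_Ico.mp ht).2.le (hBg t (by have := Finset.mem_Ico.mp ht; omega))
    · exact measurable_const.mul (hmono haM.le (hBg a le_rfl))
    · rw [lintegral_const_mul _ ((hBg a le_rfl).mono ((obsFiltration n X).le a) le_rfl)]
      refine le_trans (lintegral_mono fun ω => ?_) (lintegral_mul_delay_le hτ k a hΩ (hBg a le_rfl))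
      have hpt : ∀ t ∈ Finset.Ico (a + 1) M, (B t).indicator 1 ω * g ω =
          ((B a).indicator 1 ω * g ω) * (if (t : ℕ∞) < τ ω then (1 : ℝ≥0∞) else 0) := by
        intro t ht
        have hat : (a : ℕ∞) ≤ t := by
          have := Finset.mem_Ico.mp ht
          exact_mod_cast (by omega : a ≤ t)
        by_cases h : (t : ℕ∞) < τ ω
        · have h' := hat.trans_lt h
          simp [B, h, h']
        · simp [B, h]
      rw [Finset.sum_congr rfl hpt, ← Finset.mul_sum]
      exact mul_le_mul_right (sum_indicator_le_tsub _ _ _) _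
  have hself : ∫⁻ ω, (B a).indicator 1 ω * g ω ∂(Measure.infinitePi μ) = iidMean Q (B a) g := by
    rw [← hchange a le_rfl]
    simp
  rw [Finset.sum_congr rfl fun t ht => hchange t (Finset.mem_Ico.mp ht).1,
    Finset.sum_eq_sum_Ico_succ_bot haM, hself, add_mul, one_mul, add_comm]
  refine add_le_add ?_ le_rfl
  rw [← lintegral_finsetSum]
  · refine hle.trans_eq ?_
    rw [lintegral_const_mul _ ((hBg a le_rfl).mono ((obsFiltration n X).le a) le_rfl), hself]
  · intro t ht
    exact (hBg t (by have := Finset.mem_Ico.mp ht; omega)).mono ((obsFiltration n X).le t) le_rfl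

lemma sum_cusum_le (hm : ∀ k, 1 ≤ m k) (hn : ∑ k, m k = n)
    (hτ : IsStoppingTime (obsFiltration n X) τ) (k : Fin K) {L : (Fin n → X) → ℝ≥0}
    (hL : Measurable L) (hP : mixture n m p₀ p₁ (some k) =
      (mixture n m p₀ p₁ none).withDensity fun y => (L y : ℝ≥0∞)) (M : ℕ) :
    ∑ t ∈ Finset.range M, iidMean (mixture n m p₀ p₁ none) {ω | (t : ℕ∞) < τ ω}
        (fun ω => cusum L t ω) ≤
      (WADD m p₀ p₁ τ + 1) * ∑ t ∈ Finset.range M,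
        iidMean (mixture n m p₀ p₁ none) {ω | (t : ℕ∞) < τ ω} (fun ω => cusumPush L t ω) := by
  set Q := mixture n m p₀ p₁ none
  have hBm : ∀ t : ℕ, MeasurableSet {ω | (t : ℕ∞) < τ ω} := fun t =>
    (obsFiltration n X).le t _ (measurableSet_lt_stoppingTime hτ t)
  have hpm : ∀ a, Measurable[obsFiltration n X a] fun ω : Path n X => (cusumPush L a ω : ℝ≥0∞) :=
    fun a => measurable_coe_nnreal_ennreal.comp (measurable_cusumPush hL a)
  have hpm' : ∀ a, Measurable fun ω : Path n X => (cusumPush L a ω : ℝ≥0∞) :=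
    fun a => (hpm a).mono ((obsFiltration n X).le a) le_rfl
  have hexp : ∀ t : ℕ, iidMean Q {ω | (t : ℕ∞) < τ ω} (fun ω => cusum L t ω) =
      ∑ a ∈ Finset.range (t + 1), iidMean Q {ω | (t : ℕ∞) < τ ω}
        (fun ω => cusumPush L a ω * ∏ i ∈ Finset.Ico a t, (L (ω i) : ℝ≥0∞)) := by
    intro t
    simp only [iidMean]
    rw [← lintegral_finsetSum]
    · refine lintegral_congr fun ω => ?_
      rw [cusum_eq_sum, ← Finset.mul_sum]
      push_cast
      rfl
    · intro a _
      exact (measurable_one.indicator (hBm t)).mul ((hpm' a).mul (by fun_prop))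
  simp_rw [hexp]
  -- Grouping by the injection time `a` gives one change-point problem for each `a`, with weight
  -- `cusumPush L a`.
  rw [Finset.mul_sum, Finset.sum_comm' (t' := Finset.range M) (s' := fun a => Finset.Ico a M)
    (by intro t a; simp only [Finset.mem_range, Finset.mem_Ico]; omega)]
  exact Finset.sum_le_sum fun a ha =>
    sum_delay_le hm hn hτ k hL hP (Finset.mem_range.mp ha) (hpm a)

lemma WARL_le_tsum (hm : ∀ k, 1 ≤ m k) (hn : ∑ k, m k = n)
    (hτ : IsStoppingTime (obsFiltration n X) τ) :
    WARL m p₀ p₁ τ ≤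
      ∑' t : ℕ, iidMean (mixture n m p₀ p₁ none) {ω | (t : ℕ∞) < τ ω} fun _ => 1 := by
  have instM := isProbabilityMeasure_mixture p₀ p₁ hm hn
  have hB := measurableSet_lt_stoppingTime hτ
  have hf : ∀ t : ℕ, Measurable[obsFiltration n X t]
      fun ω => ({ω | (t : ℕ∞) < τ ω}.indicator 1 ω : ℝ≥0∞) :=
    fun t => measurable_const.indicator (hB t)
  obtain ⟨Ω, hΩ, hle⟩ := exists_labels_lintegral_le p₀ p₁ hm hn (fun _ => none) hf
  have hτeq : ∀ ω, (τ ω : ℝ≥0∞) = ∑' t : ℕ, {ω | (t : ℕ∞) < τ ω}.indicator 1 ω := fun ω => by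
    rw [enat_eq_tsum_indicator]
    simp [Set.indicator_apply]
  calc WARL m p₀ p₁ τ ≤ ∫⁻ ω, (τ ω : ℝ≥0∞) ∂(pathLaw p₀ p₁ Ω) := iInf₂_le Ω hΩ
    _ ≤ _ := by
      simp_rw [hτeq]
      refine hle.trans_eq ?_
      rw [lintegral_tsum fun t => ((hf t).mono ((obsFiltration n X).le t) le_rfl).aemeasurable]
      simp [iidMean]

lemma log_le_of_bounds {N D d ρ R γ : ℝ} (hρ : ρ < 1) (hN1 : (1 - ρ) * R ≤ N) (hR : γ / 2 ≤ R)
    (hγ : 2 / (1 - ρ) ≤ γ)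
    (hlog : Real.log N * N ≤ N + D * ((d + 1) * N)) :
    Real.log γ ≤ D * d + (D + 1 + Real.log (2 / (1 - ρ))) := by
  have h1 : 0 < 1 - ρ := by linarith
  have hγ0 : 0 < γ := lt_of_lt_of_le (by positivity) hγ
  have hN : γ * (1 - ρ) / 2 ≤ N := by nlinarith
  have hNpos : 0 < N := lt_of_lt_of_le (by positivity) hN
  have h2 : Real.log N ≤ 1 + D * (d + 1) := by
    have : Real.log N * N ≤ (1 + D * (d + 1)) * N := by linarith
    exact le_of_mul_le_mul_right this hNpos
  have h3 : Real.log γ ≤ Real.log N + Real.log (2 / (1 - ρ)) := by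
    rw [← Real.log_mul hNpos.ne' (by positivity)]
    refine Real.log_le_log hγ0 ?_
    rw [mul_div_assoc', le_div_iff₀ h1]
    linarith
  linarith

/-- The bound for one type of affected sensor. -/
lemma log_div_klDiv_le_WADD (hm : ∀ k, 1 ≤ m k) (hn : ∑ k, m k = n) (k : Fin K)
    (hp : p₁ k ≠ p₀ k)
    (hkl : InformationTheory.klDiv (mixture n m p₀ p₁ (some k)) (mixture n m p₀ p₁ none) ≠ ∞) :
    ∃ C : ℝ≥0, ∀ᶠ γ : ℝ in atTop, ∀ τ : Path n X → ℕ∞,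
      IsStoppingTime (obsFiltration n X) τ → ENNReal.ofReal γ ≤ WARL m p₀ p₁ τ →
      ENNReal.ofReal (Real.log γ) /
        InformationTheory.klDiv (mixture n m p₀ p₁ (some k)) (mixture n m p₀ p₁ none) ≤
          WADD m p₀ p₁ τ + C := by
  have instM := isProbabilityMeasure_mixture p₀ p₁ hm hn
  have hPQ := mixture_ne p₀ p₁ hm hn k hp
  set Q := mixture n m p₀ p₁ none
  set P := mixture n m p₀ p₁ (some k)
  obtain ⟨hac, hllr⟩ := InformationTheory.klDiv_ne_top_iff.mp hkl
  set L : (Fin n → X) → ℝ≥0 := fun y => (P.rnDeriv Q y).toNNReal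
  have hL : Measurable L := (Measure.measurable_rnDeriv P Q).ennreal_toNNReal
  have hP : P = Q.withDensity fun y => (L y : ℝ≥0∞) := by
    conv_lhs => rw [← Measure.withDensity_rnDeriv_eq P Q hac]
    refine withDensity_congr_ae ?_
    filter_upwards [Measure.rnDeriv_lt_top P Q] with y hy
    exact (ENNReal.coe_toNNReal hy.ne).symm
  have hL1 : ∫⁻ y, L y ∂Q = 1 := by
    have : P Set.univ = 1 := measure_univ
    rwa [hP, withDensity_apply _ MeasurableSet.univ, Measure.restrict_univ] at this
  have hint : Integrable (fun y => InformationTheory.klFun (L y)) Q :=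
    (InformationTheory.integrable_klFun_rnDeriv_iff hac).mpr hllr
  have hLne : ¬ L =ᵐ[Q] 1 := fun h => hPQ <| by
    rw [hP, withDensity_congr_ae (g := 1) (by filter_upwards [h] with y hy using by simp [hy]),
      withDensity_one]
  set D := ∫ y, InformationTheory.klFun (L y) ∂Q
  have hDeq : InformationTheory.klDiv P Q = ENNReal.ofReal D := by
    rw [← ENNReal.ofReal_toReal hkl, InformationTheory.toReal_klDiv_eq_integral_klFun hac]
    rfl
  have hDpos : 0 < D := by
    rw [← ENNReal.ofReal_pos, ← hDeq, pos_iff_ne_zero]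
    exact fun h => hPQ (InformationTheory.klDiv_eq_zero_iff.mp h)
  set ρ := ∫⁻ y, (NNReal.sqrt (L y) : ℝ≥0) ∂Q
  have hρ : ρ < 1 := lintegral_sqrt_lt_one hL hL1 hLne
  have hρ' : ρ.toReal < 1 := by
    rw [← ENNReal.toReal_one]
    exact (ENNReal.toReal_lt_toReal hρ.ne_top ENNReal.one_ne_top).mpr hρ
  -- The remainder in `log_le_of_bounds`, divided by `D`.
  refine ⟨((D + 1 + Real.log (2 / (1 - ρ.toReal))) / D).toNNReal, ?_⟩
  filter_upwards [eventually_ge_atTop (2 / (1 - ρ.toReal)), eventually_gt_atTop 0]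
    with γ hγ hγ0 τ hτ hWARL
  by_cases htop : WADD m p₀ p₁ τ = ∞
  · simp [htop]
  set B : ℕ → Set (Path n X) := fun t => {ω | (t : ℕ∞) < τ ω}
  have hB : ∀ t, MeasurableSet[obsFiltration n X t] (B t) := measurableSet_lt_stoppingTime hτ
  have hBanti : Antitone B := fun s t hst ω hω =>
    show (s : ℕ∞) < τ ω from lt_of_le_of_lt (by exact_mod_cast hst : (s : ℕ∞) ≤ t) hω
  -- Truncation keeps all sums finite even if `τ` has infinite mean; halving `γ` makes the
  -- inequality strict, so a partial sum reaches it.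
  obtain ⟨M, hM⟩ : ∃ M, ENNReal.ofReal (γ / 2) <
      ∑ t ∈ Finset.range M, iidMean Q (B t) fun _ => 1 := by
    rw [← lt_iSup_iff, ← ENNReal.tsum_eq_iSup_nat]
    refine lt_of_lt_of_le ?_ (hWARL.trans (WARL_le_tsum hm hn hτ))
    exact (ENNReal.ofReal_lt_ofReal_iff hγ0).mpr (by linarith)
  set N := ∑ t ∈ Finset.range M, iidMean Q (B t) (fun ω => cusumPush L t ω)
  set S := ∑ t ∈ Finset.range M, iidMean Q (B t) (fun ω => cusum L t ω)
  set R := ∑ t ∈ Finset.range M, iidMean Q (B t) (fun ω => (NNReal.sqrt (cusum L t ω) : ℝ≥0))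
  have hNtop : N ≠ ∞ := by
    refine (ENNReal.sum_lt_top.mpr fun t _ => lt_of_le_of_lt (iidMean_le_one fun ω => ?_)
      ENNReal.one_lt_top).ne
    exact_mod_cast cusumPush_le_one L t ω
  have hSN : S ≤ (WADD m p₀ p₁ τ + 1) * N := sum_cusum_le hm hn hτ k hL hP M
  have hRS : R ≤ S := Finset.sum_le_sum fun t _ => iidMean_mono subset_rfl fun ω => by
    have h1 := one_le_cusum L t ω
    exact_mod_cast NNReal.sqrt_le_iff_le_sq.mpr (le_self_pow₀ h1 two_ne_zero)
  have hW1 : WADD m p₀ p₁ τ + 1 ≠ ∞ := by simp [htop]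
  have hRtop : R ≠ ∞ := ((hRS.trans hSN).trans_lt (ENNReal.mul_lt_top hW1.lt_top hNtop.lt_top)).ne
  have hRN : R ≤ ρ * R + N := sum_sqrt_cusum_le hB hBanti hL M
  have hγR : ENNReal.ofReal (γ / 2) ≤ R := hM.le.trans <| Finset.sum_le_sum fun t _ =>
    iidMean_mono subset_rfl fun ω => by
      have h1 : 1 ≤ NNReal.sqrt (cusum L t ω) := by
        rw [NNReal.le_sqrt_iff_sq_le, one_pow]
        exact one_le_cusum L t ω
      exact_mod_cast h1
  have hRN' : (1 - ρ.toReal) * R.toReal ≤ N.toReal := by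
    have := ENNReal.toReal_mono (by finiteness) hRN
    rw [ENNReal.toReal_add (by finiteness) hNtop, ENNReal.toReal_mul] at this
    linarith
  have hγR' : γ / 2 ≤ R.toReal := (ENNReal.ofReal_le_iff_le_toReal hRtop).mp hγR
  -- This makes `ℓ = log N` an admissible nonnegative parameter for the entropy inequality.
  have hN1 : 1 ≤ N.toReal := by
    have h1 : 0 < 1 - ρ.toReal := by linarith
    have h2 := (div_le_iff₀ h1).mp hγ
    nlinarith
  have hlog : Real.log N.toReal * N.toReal ≤
      N.toReal + D * (((WADD m p₀ p₁ τ).toReal + 1) * N.toReal) := by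
    have hℓ := Real.log_nonneg hN1
    have h : ENNReal.ofReal (Real.log N.toReal) * N ≤
        ENNReal.ofReal (Real.exp (Real.log N.toReal)) +
          ENNReal.ofReal D * ((WADD m p₀ p₁ τ + 1) * N) :=
      (log_mul_sum_push_le hB hBanti hL hL1 hint hℓ M).trans
      (add_le_add le_rfl (mul_le_mul_right hSN _))
    rw [Real.exp_log (by linarith)] at h
    have h' := ENNReal.toReal_mono (by finiteness) h
    rw [ENNReal.toReal_add (by finiteness) (by finiteness)] at h'
    simpa [ENNReal.toReal_mul, ENNReal.toReal_add htop ENNReal.one_ne_top, hℓ, hDpos.le,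
      ENNReal.toReal_ofReal] using h'
  have hfin := log_le_of_bounds hρ' hRN' hγR' hγ hlog
  rw [hDeq, ← ENNReal.ofReal_div_of_pos hDpos, ← ENNReal.ofReal_toReal htop]
  change _ ≤ _ + ENNReal.ofReal _
  refine le_trans (ENNReal.ofReal_le_ofReal ?_) ENNReal.ofReal_add_le
  rw [div_le_iff₀ hDpos, add_mul, div_mul_cancel₀ _ hDpos.ne']
  linarith

end Main

end UnlabeledQCD

end

theorem theorem1 {X : Type*} [MeasurableSpace X] (n K : ℕ) (m : Fin K → ℕ)
    (hm : ∀ k, 1 ≤ m k) (hn : ∑ k, m k = n)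
    (p₀ p₁ : Fin K → Measure X)
    [∀ k, IsProbabilityMeasure (p₀ k)] [∀ k, IsProbabilityMeasure (p₁ k)]
    (hp : ∀ k, p₁ k ≠ p₀ k) :
    ∃ C : ℝ≥0, ∀ᶠ γ : ℝ in atTop,
      ENNReal.ofReal (Real.log γ) / UnlabeledQCD.minKL n m p₀ p₁ ≤
        (⨅ (τ : UnlabeledQCD.Path n X → ℕ∞)
            (_ : IsStoppingTime (UnlabeledQCD.obsFiltration n X) τ)
            (_ : ENNReal.ofReal γ ≤ UnlabeledQCD.WARL m p₀ p₁ τ),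
          UnlabeledQCD.WADD m p₀ p₁ τ) + C := by
  by_cases htop : UnlabeledQCD.minKL n m p₀ p₁ = ∞
  · exact ⟨0, by simp [htop]⟩
  -- For `K = 0` the infimum over types is `∞`, already excluded.
  have hne : Nonempty (Fin K) := by
    by_contra h
    rw [not_nonempty_iff] at h
    exact htop (by simp [UnlabeledQCD.minKL])
  obtain ⟨k, hk⟩ := exists_eq_ciInf_of_finite (f := fun k : Fin K =>
    InformationTheory.klDiv (UnlabeledQCD.mixture n m p₀ p₁ (some k))
      (UnlabeledQCD.mixture n m p₀ p₁ none))
  change _ = UnlabeledQCD.minKL n m p₀ p₁ at hk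
  obtain ⟨C, hC⟩ := UnlabeledQCD.log_div_klDiv_le_WADD hm hn k (hp k) (hk ▸ htop)
  refine ⟨C, ?_⟩
  filter_upwards [hC] with γ hγ
  simp_rw [ENNReal.iInf_add]
  rw [← hk]
  exact le_iInf fun τ => le_iInf fun hτ => le_iInf fun hW => hγ τ hτ hW
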